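/- Let $E_\bullet$ be a generalized homology theory, i.e. a family of functors $E_n$ ($n\in\mathbb{Z}$) from pairs of topological spaces to abelian groups, with natural boundary maps $\delta\colon E_n(Y,A)\to E_{n-1}(A)$, satisfying the Eilenberg--Steenrod axioms of homotopy invariance, exactness and excision (but not necessarily the dimension axiom). Write $\widetilde E_n(Y)=E_n(Y,\mathrm{pt})$ for a pointed space $Y$, and for a spectrum $Y=(Y_j,\ \Sigma Y_j\to Y_{j+1})_{j\ge 0}$ put $E_k(Y)=\operatorname{colim}_j \widetilde E_{k+j}(Y_j)$, where the colimit is taken along the suspension homomorphisms followed by the structure maps. Let $V\to X$ be a real vector bundle of rank $r\ge 0$ over a CW complex $X$, with a continuous fibrewise inner product. Let $D(V)$ and $\pi\colon S(V)\to X$ be its unit disc and unit sphere bundles, $\mathrm{Th}(X,V)=D(V)/S(V)$ its Thom space (with a disjoint base point if $S(V)=\emptyset$), $z\colon X\to \mathrm{Th}(X,V)$ the map given by the zero section, and $X^{V-r}=\Sigma^{-r}\Sigma^\infty\mathrm{Th}(X,V)$ the Thom spectrum of the rank-zero virtual bundle $V-\underline{\mathbb{R}}^r$. Then: 1. There is a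 pointed homotopy equivalence $h$ from the homotopy cofibre (unreduced mapping cone) $C(\pi)$ of $\pi$ to $\mathrm{Th}(X,V)$ whose composite with the canonical map $X\to C(\pi)$ is $z$. 2. There is a long exact sequence $$\cdots\to E_n(S(V))\xrightarrow{\ \pi_*\ }E_n(X)\xrightarrow{\ \psi\ }E_{n-r}(X^{V-r})\xrightarrow{\ \partial\ }E_{n-1}(S(V))\xrightarrow{\ \pi_*\ }E_{n-1}(X)\to\cdots\qquad(n\in\mathbb{Z}).$$ Here, with $s\colon\widetilde E_n(\mathrm{Th}(X,V))\to E_{n-r}(X^{V-r})$ the canonical map (from $\mathrm{Th}(X,V)$ as the $r$-th space of the spectrum), $\psi$ is the composite of the map $E_n(X)\to E_n(\mathrm{Th}(X,V))\to\widetilde E_n(\mathrm{Th}(X,V))$ induced by $z$ with $s$; and the composite of $E_n(D(V),S(V))\to\widetilde E_n(\mathrm{Th}(X,V))$, $s$ and $\partial$ is the boundary map $\delta\colon E_n(D(V),S(V))\to E_{n-1}(S(V))$ of the pair. -/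

import Mathlib

open CategoryTheory Topology Bundle

universe u v

noncomputable section

namespace SmithLES

/-! ### Generalized homology theories on pairs of topological spaces -/

/-- A continuous map `X → Y` carrying `A` into `B`, as a morphism of pairs `(X, A) ⟶ (Y, B)`. -/
def pairHom {X Y : TopCat.{u}} {A : Set X} {B : Set Y} (f : C(X, Y)) (h : Set.MapsTo f A B) :
    TopPair.ofSubset A ⟶ TopPair.ofSubset B :=
  TopPair.ofHom (X := TopPair.ofSubset A) (Y := TopPair.ofSubset B) (TopCat.ofHom f)
    (TopCat.ofHom ⟨h.restrict f A B, f.continuous.restrict h⟩) (by ext x; rfl)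

/-- The inclusion of pairs `(X ∖ U, A ∖ U) ⟶ (X, A)`. -/
def excisionMap (X : TopCat.{u}) (A U : Set X) :
    TopPair.ofSubset (X := TopCat.of (Uᶜ : Set X)) {x | (x : X) ∈ A} ⟶ TopPair.ofSubset A :=
  pairHom (X := TopCat.of (Uᶜ : Set X)) (A := {x | (x : X) ∈ A}) (B := A)
    ⟨Subtype.val, continuous_subtype_val⟩ (fun _ hx => hx)

/-- The homomorphism `Eₙ(X) ⟶ Eₙ(X, A)` induced by `(X, ∅) ⟶ (X, A)`. -/
def toRel (H : TopPair.HomologyPretheory.{u} AddCommGrpCat.{v} (ComplexShape.down ℤ))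
    (P : TopPair.{u}) (n : ℤ) : (H.H n).obj P.fst ⟶ (H.Hₚ n).obj P :=
  (H.iso n).hom.app P.fst ≫ (H.Hₚ n).map (TopPair.j P)

/-- A generalized homology theory: functors `Eₙ` (`n ∈ ℤ`) from pairs of topological spaces to
abelian groups with natural boundary maps `Eₙ(X, A) ⟶ Eₙ₋₁(A)`, subject to the Eilenberg–Steenrod
axioms except for the dimension axiom. -/
structure GeneralizedHomology extends
    TopPair.HomologyPretheory.{u} AddCommGrpCat.{v} (ComplexShape.down ℤ) where
  homotopy : toHomologyPretheory.IsHomotopyInvariant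
  exact_fst (P : TopPair.{u}) (n : ℤ) :
    Function.Exact ((toHomologyPretheory.H n).map P.map) (toRel toHomologyPretheory P n)
  exact_rel (P : TopPair.{u}) (n : ℤ) :
    Function.Exact (toRel toHomologyPretheory P n) ((toHomologyPretheory.δ n (n - 1)).app P)
  exact_snd (P : TopPair.{u}) (n : ℤ) :
    Function.Exact ((toHomologyPretheory.δ n (n - 1)).app P)
      ((toHomologyPretheory.H (n - 1)).map P.map)
  excision (X : TopCat.{u}) (A U : Set X) (h : closure U ⊆ interior A) (n : ℤ) :
    IsIso ((toHomologyPretheory.Hₚ n).map (excisionMap X A U))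

/-- A diagram chase in the exact sequences of the pairs `(Y, A)` and `(X, Y)`, used below to invert
the boundary map `Eₙ(X, Y) ⟶ Eₙ₋₁(Y, A)` if `A → X` induces isomorphisms in homology. -/
theorem bijective_of_exact {A₂ Y₂ X₂ R₂ A₁ Y₁ X₁ S₁ A₀ Y₀ X₀ : Type v} [AddCommGroup A₂]
    [AddCommGroup Y₂] [AddCommGroup X₂] [AddCommGroup R₂] [AddCommGroup A₁] [AddCommGroup Y₁]
    [AddCommGroup X₁] [AddCommGroup S₁] [AddCommGroup A₀] [AddCommGroup Y₀] [AddCommGroup X₀]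
    (f₀ : A₀ →+ Y₀) (g₀ : Y₀ →+ X₀) (f₂ : A₂ →+ Y₂) (g₂ : Y₂ →+ X₂) (f₁ : A₁ →+ Y₁) (g₁ : Y₁ →+ X₁)
    (jS : Y₁ →+ S₁) (dS : S₁ →+ A₀) (jR : X₂ →+ R₂) (dR : R₂ →+ Y₁)
    (h₁ : Function.Exact f₁ jS) (h₂ : Function.Exact jS dS) (h₃ : Function.Exact dS f₀)
    (h₄ : Function.Exact g₂ jR) (h₅ : Function.Exact jR dR) (h₆ : Function.Exact dR g₁)
    (b₂ : Function.Surjective fun a => g₂ (f₂ a)) (b₁ : Function.Bijective fun a => g₁ (f₁ a))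
    (b₀ : Function.Injective fun a => g₀ (f₀ a)) :
    Function.Bijective fun x => jS (dR x) := by
  constructor
  · refine (injective_iff_map_eq_zero (jS.comp dR)).2 fun x hx => ?_
    obtain ⟨a, ha⟩ := (h₁ _).1 hx
    have h0 : a = 0 := b₁.1 (by
      change g₁ (f₁ a) = g₁ (f₁ 0)
      rw [ha, map_zero, map_zero]
      exact (h₆ _).2 ⟨x, rfl⟩)
    rw [h0, map_zero] at ha
    obtain ⟨z, rfl⟩ := (h₅ x).1 ha.symm
    obtain ⟨b, rfl⟩ := b₂ z
    exact (h₄ _).2 ⟨_, rfl⟩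
  · intro y
    have h0 : dS y = 0 := b₀ (by
      change g₀ (f₀ _) = g₀ (f₀ 0)
      rw [(h₃ _).2 ⟨y, rfl⟩, map_zero, map_zero, map_zero])
    obtain ⟨w, rfl⟩ := (h₂ y).1 h0
    obtain ⟨a, ha⟩ := b₁.2 (g₁ w)
    obtain ⟨x, hx⟩ := (h₆ (w - f₁ a)).1 (by rw [map_sub]; exact sub_eq_zero.2 ha.symm)
    refine ⟨x, ?_⟩
    change jS (dR x) = jS w
    rw [hx, map_sub, (h₁ _).2 ⟨a, rfl⟩, sub_zero]

/-! ### Pointed spaces, quotients, cones and suspensions -/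

/-- A topological space with a base point. -/
structure PtdSpace where
  carrier : TopCat.{u}
  pt : carrier

/-- A base-point preserving continuous map. -/
structure PtdMap (Y Z : PtdSpace.{u}) where
  map : C(Y.carrier, Z.carrier)
  map_pt : map Y.pt = Z.pt

/-- The identity as a pointed map. -/
def PtdMap.id (Y : PtdSpace.{u}) : PtdMap Y Y := ⟨ContinuousMap.id _, rfl⟩

/-- The one-point space. -/
def ptdPoint : PtdSpace.{u} := ⟨TopCat.of PUnit.{u + 1}, PUnit.unit⟩

/-- The underlying set of the quotient `X/A`: the points outside `A`, and one point `none` to which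
`A` is collapsed. -/
def Collapse {X : Type u} (A : Set X) : Type u := Option ↥(Aᶜ)

/-- The projection `X → X/A`. -/
def Collapse.mk {X : Type u} (A : Set X) (x : X) : Collapse A :=
  open Classical in if h : x ∈ A then none else some ⟨x, h⟩

/-- The quotient topology. If `A` is empty, then `X/A` is `X` with a disjoint base point. -/
instance {X : Type u} [TopologicalSpace X] (A : Set X) : TopologicalSpace (Collapse A) :=
  TopologicalSpace.coinduced (Collapse.mk A) inferInstance

/-- The quotient `X/A`, with the image of `A` as base point. -/
def quot (X : Type u) [TopologicalSpace X] (A : Set X) : PtdSpace.{u} :=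
  ⟨TopCat.of (Collapse A), (none : Option ↥(Aᶜ))⟩

theorem Collapse.continuous_mk {X : Type u} [TopologicalSpace X] (A : Set X) :
    Continuous (Collapse.mk A) := continuous_coinduced_rng

theorem Collapse.mk_of_mem {X : Type u} {A : Set X} {x : X} (h : x ∈ A) :
    Collapse.mk A x = (none : Option ↥(Aᶜ)) := dif_pos h

theorem Collapse.mk_of_notMem {X : Type u} {A : Set X} {x : X} (h : x ∉ A) :
    Collapse.mk A x = (some ⟨x, h⟩ : Option ↥(Aᶜ)) := dif_neg h

/-- The map `X/A → Z` induced by a map `f : X → Z` that sends `A` to the point `z`. -/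
def Collapse.lift {X Z : Type u} {A : Set X} (f : X → Z) (z : Z) : Collapse A → Z :=
  fun x => Option.elim x z fun x => f x.1

theorem Collapse.lift_mk {X Z : Type u} {A : Set X} {f : X → Z} {z : Z} (h : ∀ x ∈ A, f x = z)
    (x : X) : Collapse.lift (A := A) f z (Collapse.mk A x) = f x := by
  by_cases hx : x ∈ A
  · rw [Collapse.mk_of_mem hx, h x hx]
    rfl
  · rw [Collapse.mk_of_notMem hx]
    rfl

theorem Collapse.continuous_lift {X Z : Type u} [TopologicalSpace X] [TopologicalSpace Z]
    {A : Set X} {f : X → Z} {z : Z} (hf : Continuous f) (h : ∀ x ∈ A, f x = z) :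
    Continuous (Collapse.lift (A := A) f z) :=
  continuous_coinduced_dom.2 (hf.congr fun x => (Collapse.lift_mk h x).symm)

/-- The pointed map `X/A → X/B` induced by the identity, for `A ⊆ B`. -/
def quotMap {X : Type u} [TopologicalSpace X] {A B : Set X} (h : A ⊆ B) :
    PtdMap (quot X A) (quot X B) where
  map := ⟨Collapse.lift (Collapse.mk B) (none : Option ↥(Bᶜ)),
    Collapse.continuous_lift (Collapse.continuous_mk B) fun _ hx => Collapse.mk_of_mem (h hx)⟩
  map_pt := rfl

/-- The subset of `Y × [0,1]` collapsed in the reduced cone. -/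
def coneSet (Y : PtdSpace.{u}) : Set (Y.carrier × unitInterval) := {p | p.2 = 0 ∨ p.1 = Y.pt}

/-- The subset of `Y × [0,1]` collapsed in the reduced suspension. -/
def suspSet (Y : PtdSpace.{u}) : Set (Y.carrier × unitInterval) :=
  {p | p.2 = 0 ∨ p.2 = 1 ∨ p.1 = Y.pt}

/-- The reduced cone `CY = (Y × [0,1]) / (Y × {0} ∪ {pt} × [0,1])`. -/
def cone (Y : PtdSpace.{u}) : PtdSpace.{u} := quot (Y.carrier × unitInterval) (coneSet Y)

/-- The reduced suspension `ΣY = (Y × [0,1]) / (Y × {0, 1} ∪ {pt} × [0,1])`. -/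
def susp (Y : PtdSpace.{u}) : PtdSpace.{u} := quot (Y.carrier × unitInterval) (suspSet Y)

/-- The inclusion `Y → CY`, `y ↦ [y, 1]`, of the base of the cone. -/
def coneBase (Y : PtdSpace.{u}) : Y.carrier ⟶ (cone Y).carrier :=
  TopCat.ofHom ⟨fun y => Collapse.mk (coneSet Y) (y, 1),
    (Collapse.continuous_mk _).comp (by fun_prop)⟩

theorem Collapse.mk_eq_iff {X : Type u} {A : Set X} {x y : X} :
    Collapse.mk A x = Collapse.mk A y ↔ x = y ∨ (x ∈ A ∧ y ∈ A) := by
  by_cases hx : x ∈ A <;> by_cases hy : y ∈ A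
  · exact iff_of_true ((Collapse.mk_of_mem hx).trans (Collapse.mk_of_mem hy).symm)
      (Or.inr ⟨hx, hy⟩)
  · simp only [Collapse.mk_of_mem hx, Collapse.mk_of_notMem hy, hx, hy]
    simp
    rintro rfl
    exact hy hx
  · simp only [Collapse.mk_of_notMem hx, Collapse.mk_of_mem hy, hx, hy]
    simp
    rintro rfl
    exact hx hy
  · simp only [Collapse.mk_of_notMem hx, Collapse.mk_of_notMem hy, hx, hy]
    refine Option.some_inj.trans ?_
    simp

theorem coneBase_isEmbedding (Y : PtdSpace.{u}) : IsEmbedding (coneBase Y).hom := by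
  refine ⟨⟨le_antisymm (coneBase Y).hom.continuous.le_induced ?_⟩, ?_⟩
  · intro U hU
    let W : Set (Collapse (coneSet Y)) :=
      {z | ∃ p : Y.carrier × unitInterval, z = Collapse.mk (coneSet Y) p ∧
        (p.1 ∈ U ∧ 0 < p.2 ∨ Y.pt ∈ U ∧ (p.1 ∈ U ∨ p.2 < 1))}
    have key : ∀ p : Y.carrier × unitInterval, Collapse.mk (coneSet Y) p ∈ W ↔
        (p.1 ∈ U ∧ 0 < p.2 ∧ Y.pt ∉ U) ∨ (Y.pt ∈ U ∧ (p.1 ∈ U ∨ p.2 < 1)) := by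
      intro p
      constructor
      · rintro ⟨q, hq, h⟩
        rcases Collapse.mk_eq_iff.1 hq with rfl | ⟨hp, hq'⟩
        · tauto
        · by_cases hU' : Y.pt ∈ U
          · refine Or.inr ⟨hU', ?_⟩
            rcases hp with hp | hp
            · right; rw [hp]; exact zero_lt_one
            · left; rw [hp]; exact hU'
          · exfalso
            rcases h with ⟨h1, h2⟩ | h
            · rcases hq' with hq' | hq'
              · exact h2.ne' hq'
              · exact hU' (hq' ▸ h1)
            · exact hU' h.1
      · intro h
        exact ⟨p, rfl, by tauto⟩
    refine ⟨W, ?_, ?_⟩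
    · refine isOpen_coinduced.2 ?_
      have : Collapse.mk (coneSet Y) ⁻¹' W =
          {p | (p.1 ∈ U ∧ 0 < p.2 ∧ Y.pt ∉ U) ∨ (Y.pt ∈ U ∧ (p.1 ∈ U ∨ p.2 < 1))} :=
        Set.ext key
      change IsOpen (X := Y.carrier × unitInterval) (Collapse.mk (coneSet Y) ⁻¹' W)
      rw [this]
      have h1 : IsOpen {p : Y.carrier × unitInterval | p.1 ∈ U} := hU.preimage continuous_fst
      have h2 : IsOpen {p : Y.carrier × unitInterval | 0 < p.2} :=
        isOpen_lt continuous_const continuous_snd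
      have h3 : IsOpen {p : Y.carrier × unitInterval | p.2 < 1} :=
        isOpen_lt continuous_snd continuous_const
      by_cases hU' : Y.pt ∈ U
      · simpa [hU', Set.union_def] using h1.union h3
      · simpa [hU', Set.inter_def] using h1.inter h2
    · ext y
      refine (key (y, 1)).trans ?_
      simp only [zero_lt_one, true_and, lt_irrefl, or_false]
      tauto
  · intro y y' h
    rcases Collapse.mk_eq_iff.1 h with h | ⟨h, h'⟩
    · exact congrArg Prod.fst h
    · simp only [coneSet, Set.mem_ofPred_eq, one_ne_zero, false_or] at h h'
      rw [h, h']

/-- The pair `(CY, Y)`. -/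
def conePair (Y : PtdSpace.{u}) : TopPair.{u} := TopPair.of (coneBase Y) (coneBase_isEmbedding Y)

/-- The pair `(Y, {pt})`. -/
def ptdPair (Y : PtdSpace.{u}) : TopPair.{u} := TopPair.ofSubset {Y.pt}

/-- A pointed map as a morphism of pairs. -/
def PtdMap.toPair {Y Z : PtdSpace.{u}} (f : PtdMap Y Z) : ptdPair Y ⟶ ptdPair Z :=
  pairHom f.map (by rintro _ rfl; exact f.map_pt)

/-- The morphism of pairs `(CY, Y) ⟶ (ΣY, {pt})` collapsing the base of the cone. -/
def coneToSusp (Y : PtdSpace.{u}) : conePair Y ⟶ ptdPair (susp Y) :=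
  TopPair.ofHom (X := conePair Y) (Y := ptdPair (susp Y))
    (TopCat.ofHom (quotMap (A := coneSet Y) (B := suspSet Y)
      (by rintro p (h | h); exacts [Or.inl h, Or.inr (Or.inr h)])).map)
    (TopCat.ofHom (ContinuousMap.const _ ⟨(susp Y).pt, rfl⟩))
    (by
      ext y
      exact ((Collapse.lift_mk (A := coneSet Y) (x := (y, 1))
        (fun x hx => Collapse.mk_of_mem (A := suspSet Y)
          (by rcases hx with h | h; exacts [Or.inl h, Or.inr (Or.inr h)]))).trans
        (Collapse.mk_of_mem (A := suspSet Y) (Or.inr (Or.inl rfl)))).symm)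

/-- The contraction of the cone onto its base point. -/
theorem cone_contraction (Y : PtdSpace.{u}) :
    Nonempty (ContinuousMap.Homotopy (ContinuousMap.id (cone Y).carrier)
      (ContinuousMap.const _ (cone Y).pt)) := by
  have hq : IsQuotientMap (Collapse.mk (coneSet Y)) := by
    refine ⟨⟨rfl⟩, ?_⟩
    rintro (_ | x)
    · exact ⟨(Y.pt, 0), Collapse.mk_of_mem (Or.inl rfl)⟩
    · exact ⟨x.1, Collapse.mk_of_notMem x.2⟩
  let F : unitInterval × Collapse (coneSet Y) → Collapse (coneSet Y) := fun p =>
    Option.elim p.2 (none : Option ↥((coneSet Y)ᶜ))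
      (fun x => Collapse.mk (coneSet Y) (x.1.1, unitInterval.symm p.1 * x.1.2))
  have hF : ∀ s p, F (s, Collapse.mk (coneSet Y) p) =
      Collapse.mk (coneSet Y) (p.1, unitInterval.symm s * p.2) := by
    intro s p
    by_cases hp : p ∈ coneSet Y
    · have : (p.1, unitInterval.symm s * p.2) ∈ coneSet Y := by
        rcases hp with hp | hp
        · left; simp [hp]
        · right; exact hp
      rw [Collapse.mk_of_mem hp, Collapse.mk_of_mem this]
      rfl
    · rw [Collapse.mk_of_notMem hp]
      rfl
  have hc : Continuous F := by
    refine hq.continuous_lift_prod_right ?_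
    have h2 : Continuous fun p : unitInterval × (Y.carrier × unitInterval) =>
        Collapse.mk (coneSet Y) (p.2.1, unitInterval.symm p.1 * p.2.2) :=
      (Collapse.continuous_mk _).comp (by fun_prop)
    exact h2.congr fun p => (hF p.1 p.2).symm
  refine ⟨⟨⟨F, hc⟩, ?_, ?_⟩⟩
  · intro z
    obtain ⟨p, rfl⟩ := hq.surjective z
    change F (0, _) = _
    rw [hF, unitInterval.symm_zero, one_mul]
    rfl
  · intro z
    obtain ⟨p, rfl⟩ := hq.surjective z
    change F (1, _) = _
    rw [hF]
    exact Collapse.mk_of_mem (Or.inl (by simp))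

namespace GeneralizedHomology

variable (E : GeneralizedHomology.{u, v})

/-- The homology of a space, `Eₙ(X)`. -/
abbrev space (n : ℤ) (X : TopCat.{u}) : AddCommGrpCat.{v} := (E.H n).obj X

/-- The reduced homology of a pointed space, `Ẽₙ(Y) = Eₙ(Y, {pt})`. -/
def reduced (n : ℤ) (Y : PtdSpace.{u}) : AddCommGrpCat.{v} := (E.Hₚ n).obj (ptdPair Y)

/-- The homomorphism on reduced homology induced by a pointed map. -/
def reducedMap (n : ℤ) {Y Z : PtdSpace.{u}} (f : PtdMap Y Z) : E.reduced n Y ⟶ E.reduced n Z :=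
  (E.Hₚ n).map f.toPair

/-- The boundary map `Eₙ(CY, Y) ⟶ Eₘ(Y) ⟶ Ẽₘ(Y)`, for `n = m + 1`. -/
def coneBoundary (Y : PtdSpace.{u}) (m n : ℤ) :
    (E.Hₚ n).obj (conePair Y) ⟶ E.reduced m Y :=
  (E.δ n m).app (conePair Y) ≫ toRel E.toHomologyPretheory (ptdPair Y) m

theorem map_eq_of_homotopy {X Y : TopCat.{u}} (f g : X ⟶ Y) (F : TopCat.Homotopy f g) (n : ℤ) :
    (E.H n).map f = (E.H n).map g := by
  have h := E.homotopy.map_eq_of_homotopy (f := TopPair.incl.map f) (g := TopPair.incl.map g)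
    { fst := F
      snd := TopCat.Homotopy.refl _
      w := by
        ext x
        exact x.1.elim } n
  have h1 := (E.iso n).hom.naturality f
  have h2 := (E.iso n).hom.naturality g
  simp only [Functor.comp_map] at h1 h2
  rw [← cancel_mono ((E.iso n).hom.app Y), h1, h2, h]

theorem isIso_point_cone (Y : PtdSpace.{u}) (n : ℤ) :
    IsIso ((E.H n).map ((ptdPair Y).map ≫ coneBase Y)) := by
  obtain ⟨F⟩ := cone_contraction Y
  have hpt : ∀ x : ((ptdPair Y).snd : Type u), x = ⟨Y.pt, rfl⟩ := fun x => Subtype.ext x.2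
  let r : (cone Y).carrier ⟶ (ptdPair Y).snd :=
    TopCat.ofHom (ContinuousMap.const _ ⟨Y.pt, rfl⟩)
  refine ⟨(E.H n).map r, ?_, ?_⟩
  · rw [← (E.H n).map_comp, ← (E.H n).map_id]
    congr 1
    ext x
    rw [hpt x]
    rfl
  · rw [← (E.H n).map_comp, ← (E.H n).map_id]
    refine (E.map_eq_of_homotopy _ _ (F.cast rfl ?_) n).symm
    ext x
    exact (Collapse.mk_of_mem (A := coneSet Y) (x := (Y.pt, 1)) (Or.inr rfl)).symm

theorem isIso_coneBoundary (Y : PtdSpace.{u}) (m n : ℤ) (h : m + 1 = n) :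
    IsIso (E.coneBoundary Y m n) := by
  obtain rfl : m = n - 1 := by omega
  have hbij : ∀ k, Function.Bijective fun a =>
      (E.H k).map (conePair Y).map ((E.H k).map (ptdPair Y).map a) := fun k => by
    have := E.isIso_point_cone Y k
    have h := ConcreteCategory.bijective_of_isIso ((E.H k).map ((ptdPair Y).map ≫ coneBase Y))
    have h' := (E.H k).map_comp (ptdPair Y).map (coneBase Y)
    have e : ⇑((E.H k).map ((ptdPair Y).map ≫ coneBase Y)) =
      fun a => (E.H k).map (conePair Y).map ((E.H k).map (ptdPair Y).map a) :=
      funext fun a => congrArg (fun f => f a) h'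
    exact e ▸ h
  rw [ConcreteCategory.isIso_iff_bijective]
  exact bijective_of_exact _ _ ((E.H n).map (ptdPair Y).map).hom _ _ _ _ _ _ _
    (E.exact_fst (ptdPair Y) (n - 1)) (E.exact_rel (ptdPair Y) (n - 1))
    (E.exact_snd (ptdPair Y) (n - 1)) (E.exact_fst (conePair Y) n) (E.exact_rel (conePair Y) n)
    (E.exact_snd (conePair Y) n) (hbij n).2 (hbij (n - 1)) (hbij (n - 1 - 1)).1

/-- The suspension homomorphism `Ẽₘ(Y) ≅ Eₙ(CY, Y) ⟶ Ẽₙ(ΣY)`, for `n = m + 1`. -/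
def suspHom (Y : PtdSpace.{u}) (m n : ℤ) (h : m + 1 = n) :
    E.reduced m Y ⟶ E.reduced n (susp Y) :=
  have := E.isIso_coneBoundary Y m n h
  inv (E.coneBoundary Y m n) ≫ (E.Hₚ n).map (coneToSusp Y)

end GeneralizedHomology

/-! ### Spectra and their homology -/

/-- A (sequential) spectrum: pointed spaces `Y₀, Y₁, …` with pointed maps `ΣYⱼ → Yⱼ₊₁`. -/
structure Spectrum where
  level : ℕ → PtdSpace.{u}
  bond (j : ℕ) : PtdMap (susp (level j)) (level (j + 1))

/-- The iterated suspensions `ΣʲY`. -/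
def iterSusp (Y : PtdSpace.{u}) : ℕ → PtdSpace.{u}
  | 0 => Y
  | j + 1 => susp (iterSusp Y j)

/-- The suspension spectrum `Σ^∞ Y`. -/
def suspSpectrum (Y : PtdSpace.{u}) : Spectrum.{u} where
  level := iterSusp Y
  bond j := PtdMap.id (iterSusp Y (j + 1))

/-- The desuspension `Σ⁻¹Y` of a spectrum: the shift `pt, Y₀, Y₁, …`. -/
def Spectrum.desusp (Y : Spectrum.{u}) : Spectrum.{u} where
  level
    | 0 => ptdPoint
    | j + 1 => Y.level j
  bond
    | 0 => ⟨ContinuousMap.const _ (Y.level 0).pt, rfl⟩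
    | j + 1 => Y.bond j

/-- The iterated desuspension `Σ⁻ʳY`. -/
def Spectrum.iterDesusp (Y : Spectrum.{u}) : ℕ → Spectrum.{u}
  | 0 => Y
  | r + 1 => (Y.iterDesusp r).desusp

/-- The identification of `Y₀` with the `r`-th space of `Σ⁻ʳY`. -/
def Spectrum.bottom (Y : Spectrum.{u}) : (r : ℕ) → PtdMap (Y.level 0) ((Y.iterDesusp r).level r)
  | 0 => PtdMap.id _
  | r + 1 => Y.bottom r

namespace GeneralizedHomology

variable (E : GeneralizedHomology.{u, v})

/-- The sequence `Ẽₖ(Y₀) ⟶ Ẽₖ₊₁(Y₁) ⟶ Ẽₖ₊₂(Y₂) ⟶ …` of suspension homomorphisms followed by the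
structure maps of the spectrum. -/
def spectrumSystem (k : ℤ) (Y : Spectrum.{u}) : ℕ ⥤ AddCommGrpCat.{v} :=
  Functor.ofSequence (X := fun j : ℕ => E.reduced (k + j) (Y.level j)) fun j =>
    E.suspHom (Y.level j) (k + j) (k + (j + 1 : ℕ)) (by push_cast; ring) ≫
      E.reducedMap _ (Y.bond j)

/-- The homology of a spectrum, `Eₖ(Y) = colimⱼ Ẽₖ₊ⱼ(Yⱼ)`. -/
def spectrum (k : ℤ) (Y : Spectrum.{u}) : AddCommGrpCat.{v} :=
  Limits.colimit (E.spectrumSystem k Y)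

/-- The canonical map `Ẽₙ(Yⱼ) ⟶ Eₖ(Y)`, for `n = k + j`. -/
def spectrumι (Y : Spectrum.{u}) (k : ℤ) (j : ℕ) (n : ℤ) (h : n = k + j) :
    E.reduced n (Y.level j) ⟶ E.spectrum k Y :=
  eqToHom (by rw [h]; rfl) ≫ Limits.colimit.ι (E.spectrumSystem k Y) j

/-- The canonical map `Ẽₙ(Z) ⟶ Eₙ₋ᵣ(Σ⁻ʳ Σ^∞ Z)`, from `Z` as the `r`-th space of the spectrum. -/
def stabilize (Z : PtdSpace.{u}) (r : ℕ) (n : ℤ) :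
    E.reduced n Z ⟶ E.spectrum (n - r) ((suspSpectrum Z).iterDesusp r) :=
  E.reducedMap n ((suspSpectrum Z).bottom r) ≫
    E.spectrumι ((suspSpectrum Z).iterDesusp r) (n - r) r n (by ring)

end GeneralizedHomology

/-! ### Homotopy cofibres -/

/-- The gluing relation of the mapping cone of `f : A → B`. -/
inductive CofibreRel {A B : Type u} (f : A → B) : B ⊕ (A × unitInterval) ⊕ PUnit.{u + 1} →
    B ⊕ (A × unitInterval) ⊕ PUnit.{u + 1} → Prop
  | zero (a : A) : CofibreRel f (.inr (.inl (a, 0))) (.inl (f a))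
  | one (a : A) : CofibreRel f (.inr (.inl (a, 1))) (.inr (.inr PUnit.unit))

/-- The homotopy cofibre (unreduced mapping cone) of a map `f : A → B`: the quotient of
`B ⊔ A × [0,1] ⊔ pt` by `(a, 0) ∼ f a` and `(a, 1) ∼ pt`, based at the cone point. -/
def cofibre {A B : Type u} [TopologicalSpace A] [TopologicalSpace B] (f : C(A, B)) :
    PtdSpace.{u} :=
  ⟨TopCat.of (Quot (CofibreRel f)), Quot.mk _ (.inr (.inr PUnit.unit))⟩

/-- The canonical map from `B` to the homotopy cofibre of `f : A → B`. -/
def toCofibre {A B : Type u} [TopologicalSpace A] [TopologicalSpace B] (f : C(A, B)) :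
    C(B, (cofibre f).carrier) :=
  ⟨fun b => Quot.mk _ (.inl b), continuous_quot_mk.comp continuous_inl⟩

/-- A pointed map is a pointed homotopy equivalence if it has an inverse up to pointed homotopy. -/
def PtdMap.IsHomotopyEquiv {Y Z : PtdSpace.{u}} (f : PtdMap Y Z) : Prop :=
  ∃ g : PtdMap Z Y,
    (g.map.comp f.map).HomotopicRel (ContinuousMap.id _) {Y.pt} ∧
    (f.map.comp g.map).HomotopicRel (ContinuousMap.id _) {Z.pt}

/-! ### Sphere bundles, disc bundles and Thom spectra -/

section Thom

variable {r : ℕ} {X : Type u} [TopologicalSpace X] {V : X → Type u}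
  [TopologicalSpace (TotalSpace (EuclideanSpace ℝ (Fin r)) V)]
  [∀ x, TopologicalSpace (V x)] [∀ x, AddCommGroup (V x)] [∀ x, Module ℝ (V x)]
  [FiberBundle (EuclideanSpace ℝ (Fin r)) V] [VectorBundle ℝ (EuclideanSpace ℝ (Fin r)) V]
  (g : ContinuousRiemannianMetric (EuclideanSpace ℝ (Fin r)) V)

/-- The total space `D(V)` of the disc bundle: vectors of length at most one. -/
abbrev Disc : Type u :=
  {p : TotalSpace (EuclideanSpace ℝ (Fin r)) V // g.inner p.proj p.2 p.2 ≤ 1}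

/-- The total space `S(V)` of the sphere bundle: vectors of length one. -/
abbrev Sphere : Type u :=
  {p : TotalSpace (EuclideanSpace ℝ (Fin r)) V // g.inner p.proj p.2 p.2 = 1}

/-- The projection `π : S(V) → X`. -/
def sphereProj : C(Sphere g, X) :=
  ⟨fun p => p.1.proj, (FiberBundle.continuous_proj _ _).comp continuous_subtype_val⟩

/-- The inclusion `S(V) → D(V)`. -/
def sphereIncl : C(Sphere g, Disc g) :=
  ⟨fun p => ⟨p.1, p.2.le⟩, continuous_subtype_val.subtype_mk _⟩

theorem sphereIncl_isEmbedding : IsEmbedding (sphereIncl g) :=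
  IsEmbedding.of_comp (sphereIncl g).continuous continuous_subtype_val
    (IsEmbedding.subtypeVal (p := fun p : TotalSpace (EuclideanSpace ℝ (Fin r)) V =>
      g.inner p.proj p.2 p.2 = 1))

/-- The pair `(D(V), S(V))`. -/
def discPair : TopPair.{u} :=
  TopPair.of (A := TopCat.of (Sphere g)) (X := TopCat.of (Disc g)) (TopCat.ofHom (sphereIncl g))
    (sphereIncl_isEmbedding g)

/-- The Thom space `Th(X, V) = D(V)/S(V)`. -/
def thomSpace : PtdSpace.{u} := quot (Disc g) (Set.range (sphereIncl g))

/-- The quotient map of pairs `(D(V), S(V)) ⟶ (Th(X, V), {pt})`. -/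
def discToThom : discPair g ⟶ ptdPair (thomSpace g) :=
  TopPair.ofHom (X := discPair g) (Y := ptdPair (thomSpace g))
    (TopCat.ofHom ⟨Collapse.mk _, Collapse.continuous_mk _⟩)
    (TopCat.ofHom (ContinuousMap.const _ ⟨(thomSpace g).pt, rfl⟩))
    (by
      ext p
      exact (Collapse.mk_of_mem (A := Set.range (sphereIncl g)) ⟨p, rfl⟩).symm)

/-- The zero section `X → D(V)`. -/
def zeroToDisc : C(X, Disc g) where
  toFun x := ⟨⟨x, 0⟩, by
    have h : g.inner x 0 0 ≤ 1 := by rw [map_zero]; exact zero_le_one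
    exact h⟩
  continuous_toFun := by
    have h : Continuous (zeroSection (EuclideanSpace ℝ (Fin r)) V) :=
      Trivialization.continuous_zeroSection ℝ
    exact h.subtype_mk _

/-- The composite `X → D(V) → Th(X, V)` of the zero section and the quotient map. -/
def zeroToThom : C(X, (thomSpace g).carrier) :=
  ContinuousMap.comp ⟨Collapse.mk (Set.range (sphereIncl g)), Collapse.continuous_mk _⟩
    (zeroToDisc g)

/-- The Thom spectrum `X^{V - r} = Σ⁻ʳ Σ^∞ Th(X, V)` of the rank-zero virtual vector bundle
`V - ℝʳ`. -/
def thomSpectrum : Spectrum.{u} := (suspSpectrum (thomSpace g)).iterDesusp r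

end Thom

end SmithLES

end

/-!
The inclusion of the sphere bundle `S(V)` in the disc bundle `D(V)` is, up to the homotopy
equivalence `D(V) → X`, the projection `π : S(V) → X`. The asserted long exact sequence is therefore
the sequence of the pair `(D(V), S(V))`, once `Eₙ(D(V), S(V))` is identified with `Eₙ₋ᵣ(X^{V-r})`.

Two identifications are needed. First, `Eₙ(D(V), S(V)) ≅ Ẽₙ(Th(X, V))`: the axioms give excision
only for sets whose closure lies in an interior, so a collapsed subspace `A` needs a neighbourhood
`W` that deforms into it. Such data are called a `NhdDeformation`; with them the quotient map
induces an isomorphism on homology (`isIso_map_collapseHom`), because `A` may be enlarged to `W` and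
then excised. For `S(V) ⊆ D(V)` the deformation is radial. Second, the canonical map from
`Ẽₙ(Th(X, V))` to the colimit `Eₙ₋ᵣ(X^{V-r})` is an isomorphism (`isIso_stabilize`): the Thom space
is well-pointed, reduced suspensions of well-pointed spaces are well-pointed, and for these the
suspension homomorphism is an isomorphism (`isIso_suspHom`). Neighbourhood deformations are not
required to be stationary on `A`, which makes their products and quotients immediate.

The mapping cone of `π` is compared with the Thom space by polar coordinates, `(v, s) ↦ s v`. The
homotopy inverse projects the vectors of length at most `1/2` to `X` and stretches the others
radially; unlike the honest inverse of polar coordinates, it is continuous by pasting along closed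
sets, with no compactness argument. Both homotopies move radial coordinates linearly.
-/

noncomputable section

namespace SmithLES

/-! ### Neighbourhood deformations and quotients -/

/-- A closed set `A` with an open neighbourhood `W` and a deformation of the whole space that
preserves `A` and `W` and ends by carrying `W` into `A`. The deformation need not be stationary on
`A`, so that such data multiply without reparametrization. -/
structure NhdDeformation {X : Type u} [TopologicalSpace X] (A W : Set X) where
  isClosed : IsClosed A
  isOpen : IsOpen W
  subset : A ⊆ W
  deform : C(unitInterval × X, X)
  deform_zero (x : X) : deform (0, x) = x
  mapsTo_left (t : unitInterval) : Set.MapsTo (fun x => deform (t, x)) A A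
  mapsTo_right (t : unitInterval) : Set.MapsTo (fun x => deform (t, x)) W W
  deform_one : Set.MapsTo (fun x => deform (1, x)) W A

/-- The points `0` and `1` of the unit interval, with the points at distance less than `1/4` from
them; the deformation stretches the interval about its centre and clamps the result. -/
def unitIntervalEnds : NhdDeformation {s : unitInterval | s = 0 ∨ s = 1}
    {s : unitInterval | (s : ℝ) < 1 / 4 ∨ 3 / 4 < (s : ℝ)} where
  isClosed := (isClosed_singleton (x := (0 : unitInterval))).union isClosed_singleton
  isOpen := (isOpen_lt continuous_subtype_val continuous_const).union
    (isOpen_lt continuous_const continuous_subtype_val)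
  subset := by
    rintro s (rfl | rfl)
    · left; norm_num
    · right; norm_num
  deform := ⟨fun p => Set.projIcc (0 : ℝ) 1 zero_le_one (p.2 + p.1 * (p.2 - 1 / 2)),
    continuous_projIcc.comp (by fun_prop)⟩
  deform_zero s := by
    have : ((s : ℝ) + ((0 : unitInterval) : ℝ) * (s - 1 / 2)) = s := by simp
    change Set.projIcc (0 : ℝ) 1 zero_le_one _ = s
    rw [this, Set.projIcc_val]
  mapsTo_left t := by
    rintro s (rfl | rfl)
    · refine Or.inl (Set.projIcc_of_le_left zero_le_one ?_)
      have := t.2.1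
      simp; linarith
    · refine Or.inr (Set.projIcc_of_right_le zero_le_one ?_)
      have := t.2.1
      simp; linarith
  mapsTo_right t := by
    have ht := t.2.1
    rintro s (h | h)
    · left
      simp only [ContinuousMap.coe_mk, Set.coe_projIcc]
      have : (t : ℝ) * (s - 1 / 2) ≤ 0 := mul_nonpos_of_nonneg_of_nonpos ht (by linarith)
      exact max_lt (by norm_num) (min_lt_of_right_lt (by linarith))
    · right
      simp only [ContinuousMap.coe_mk, Set.coe_projIcc]
      have : 0 ≤ (t : ℝ) * (s - 1 / 2) := mul_nonneg ht (by linarith)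
      exact lt_max_of_lt_right (lt_min (by norm_num) (by linarith))
  deform_one := by
    rintro s (h | h)
    · refine Or.inl (Set.projIcc_of_le_left zero_le_one ?_)
      simp; linarith
    · refine Or.inr (Set.projIcc_of_right_le zero_le_one ?_)
      simp; linarith

/-- The product `(X, A) × (Y, B) = (X × Y, A × Y ∪ X × B)` of neighbourhood deformations. -/
def NhdDeformation.prod {X Y : Type*} [TopologicalSpace X] [TopologicalSpace Y]
    {A W : Set X} {B U : Set Y} (d : NhdDeformation A W) (e : NhdDeformation B U) :
    NhdDeformation {p : X × Y | p.1 ∈ A ∨ p.2 ∈ B} {p : X × Y | p.1 ∈ W ∨ p.2 ∈ U} where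
  isClosed := (d.isClosed.preimage continuous_fst).union (e.isClosed.preimage continuous_snd)
  isOpen := (d.isOpen.preimage continuous_fst).union (e.isOpen.preimage continuous_snd)
  subset _ h := h.imp (fun h => d.subset h) (fun h => e.subset h)
  deform := ⟨fun p => (d.deform (p.1, p.2.1), e.deform (p.1, p.2.2)), by fun_prop⟩
  deform_zero p := Prod.ext (d.deform_zero _) (e.deform_zero _)
  mapsTo_left t _ h := h.imp (fun h => d.mapsTo_left t h) (fun h => e.mapsTo_left t h)
  mapsTo_right t _ h := h.imp (fun h => d.mapsTo_right t h) (fun h => e.mapsTo_right t h)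
  deform_one _ h := h.imp (fun h => d.deform_one h) (fun h => e.deform_one h)

theorem continuous_of_prod_sum {T Y₁ Y₂ Z : Type*} [TopologicalSpace T] [TopologicalSpace Y₁]
    [TopologicalSpace Y₂] [TopologicalSpace Z] {F : T × (Y₁ ⊕ Y₂) → Z}
    (h₁ : Continuous fun p : T × Y₁ => F (p.1, .inl p.2))
    (h₂ : Continuous fun p : T × Y₂ => F (p.1, .inr p.2)) : Continuous F := by
  rw [← (Homeomorph.prodSumDistrib (X := T) (Y := Y₁) (Z := Y₂)).symm.comp_continuous_iff']
  exact continuous_sum_dom.2 ⟨h₁, h₂⟩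

namespace Collapse

/-- Adding a point to `X` makes `X → X/A` a quotient map even if `A` is empty. -/
theorem isQuotientMap_sumElim {X : Type u} [TopologicalSpace X] (A : Set X) :
    IsQuotientMap (Sum.elim (mk A) fun _ : Unit => (none : Option ↥(Aᶜ))) := by
  refine ⟨isCoinducing_iff.2 fun U => ⟨fun hU => isOpen_coinduced.2 (isOpen_sum_iff.1 hU).1,
    fun hU => hU.preimage ((continuous_mk A).sumElim continuous_const)⟩, ?_⟩
  rintro (_ | x)
  · exact ⟨.inr (), rfl⟩
  · exact ⟨.inl x.1, mk_of_notMem x.2⟩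

theorem continuous_of_prod {T X Z : Type*} [TopologicalSpace T] [LocallyCompactSpace T]
    [TopologicalSpace X] [TopologicalSpace Z] {A : Set X} {F : T × Collapse A → Z}
    (h : Continuous fun p : T × X => F (p.1, mk A p.2))
    (h₀ : Continuous fun t : T => F (t, (none : Option ↥(Aᶜ)))) : Continuous F :=
  (isQuotientMap_sumElim A).continuous_lift_prod_right
    (continuous_of_prod_sum h (h₀.comp continuous_fst))

/-- The image of a set `S` in `X/A`, together with the base point. -/
def image {X : Type u} (A S : Set X) : Set (Collapse A) :=
  insert (none : Option ↥(Aᶜ)) (mk A '' S)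

theorem mk_mem_image {X : Type u} {A S : Set X} (h : A ⊆ S) {x : X} :
    mk A x ∈ image A S ↔ x ∈ S := by
  refine ⟨?_, fun hx => Or.inr ⟨x, hx, rfl⟩⟩
  rintro (hx | ⟨y, hy, hxy⟩)
  · by_contra hS
    rw [mk_of_notMem fun hA => hS (h hA)] at hx
    cases hx
  · rcases mk_eq_iff.1 hxy with rfl | ⟨-, hA⟩
    exacts [hy, h hA]

theorem image_self {X : Type u} (A : Set X) : image A A = {(none : Option ↥(Aᶜ))} := by
  refine Set.ext fun z => ⟨?_, Or.inl⟩
  rintro (rfl | ⟨x, hx, rfl⟩)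
  exacts [rfl, mk_of_mem hx]

theorem isOpen_image {X : Type u} [TopologicalSpace X] {A S : Set X} (h : A ⊆ S)
    (hS : IsOpen S) : IsOpen (image A S) := by
  refine isOpen_coinduced.2 ?_
  have : mk A ⁻¹' image A S = S := Set.ext fun x => mk_mem_image h
  rwa [this]

theorem isClosed_image {X : Type u} [TopologicalSpace X] {A S : Set X} (h : A ⊆ S)
    (hS : IsClosed S) : IsClosed (image A S) := by
  refine isOpen_compl_iff.1 (isOpen_coinduced.2 ?_)
  have : mk A ⁻¹' (image A S)ᶜ = Sᶜ := Set.ext fun x => not_congr (mk_mem_image h)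
  rw [this]
  exact hS.isOpen_compl

end Collapse

/-- A neighbourhood deformation whose homotopy preserves a subset `C ⊆ A` descends to `X/C`. -/
def NhdDeformation.collapse {X : Type u} [TopologicalSpace X] {A W C : Set X}
    (d : NhdDeformation A W) (hC : C ⊆ A)
    (hd : ∀ t, Set.MapsTo (fun x => d.deform (t, x)) C C) :
    NhdDeformation (Collapse.image C A) (Collapse.image C W) :=
  let F : unitInterval × Collapse C → Collapse C := fun p =>
    Collapse.lift (fun x => Collapse.mk C (d.deform (p.1, x))) (none : Option ↥(Cᶜ)) p.2
  have hF : ∀ t x, F (t, Collapse.mk C x) = Collapse.mk C (d.deform (t, x)) := fun t =>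
    Collapse.lift_mk fun _ hx => Collapse.mk_of_mem (hd t hx)
  have hmaps : ∀ {S T : Set X} (t : unitInterval),
      Set.MapsTo (fun x => d.deform (t, x)) S T →
      Set.MapsTo (fun z => F (t, z)) (Collapse.image C S) (Collapse.image C T) := by
    rintro S T t h z (rfl | ⟨x, hx, rfl⟩)
    · exact Or.inl rfl
    · exact Or.inr ⟨_, h hx, (hF t x).symm⟩
  { isClosed := Collapse.isClosed_image hC d.isClosed
    isOpen := Collapse.isOpen_image (hC.trans d.subset) d.isOpen
    subset := Set.insert_subset_insert (Set.image_mono d.subset)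
    deform := ⟨F, Collapse.continuous_of_prod
      (((Collapse.continuous_mk C).comp d.deform.continuous).congr fun p => (hF p.1 p.2).symm)
      continuous_const⟩
    deform_zero := by
      rintro (_ | x)
      · rfl
      · exact (congrArg (Collapse.mk C) (d.deform_zero _)).trans (Collapse.mk_of_notMem x.2)
    mapsTo_left := fun t => hmaps t (d.mapsTo_left t)
    mapsTo_right := fun t => hmaps t (d.mapsTo_right t)
    deform_one := hmaps 1 d.deform_one }

/-! ### Excision for quotients -/

/-- The morphism of pairs `(X, A) ⟶ (X, W)` given by the identity of `X`, for `A ⊆ W`. -/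
def inclHom {X : TopCat.{u}} {A W : Set X} (h : A ⊆ W) :
    TopPair.ofSubset A ⟶ TopPair.ofSubset W :=
  pairHom (ContinuousMap.id X) fun _ hx => h hx

namespace GeneralizedHomology

variable (E : GeneralizedHomology.{u, v})

theorem map_pairHom_eq_of_homotopy {X Y : TopCat.{u}} {A : Set X} {B : Set Y} {f g : C(X, Y)}
    (hf : Set.MapsTo f A B) (hg : Set.MapsTo g A B) (F : f.Homotopy g)
    (hF : ∀ t, Set.MapsTo (fun x => F (t, x)) A B) (n : ℤ) :
    (E.Hₚ n).map (pairHom f hf) = (E.Hₚ n).map (pairHom g hg) :=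
  let G : ContinuousMap.Homotopy (⟨hf.restrict f A B, f.continuous.restrict hf⟩ : C(A, B))
      ⟨hg.restrict g A B, g.continuous.restrict hg⟩ :=
    { toFun := fun p => ⟨F (p.1, p.2.1), hF p.1 p.2.2⟩
      continuous_toFun := by fun_prop
      map_zero_left := fun x => Subtype.ext (F.map_zero_left x.1)
      map_one_left := fun x => Subtype.ext (F.map_one_left x.1) }
  E.homotopy.map_eq_of_homotopy
    { fst := F
      snd := G
      w := by
        ext x
        rfl } n

/-- The end of the deformation is a homotopy inverse of `(X, A) ⟶ (X, W)`. -/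
theorem isIso_map_nhd {X : TopCat.{u}} {A W : Set X} (d : NhdDeformation A W) (n : ℤ) :
    IsIso ((E.Hₚ n).map (inclHom d.subset)) := by
  let ρ : C(X, X) := d.deform.comp ⟨fun x => (1, x), by fun_prop⟩
  let F : (ContinuousMap.id X).Homotopy ρ := ⟨d.deform, d.deform_zero, fun _ => rfl⟩
  refine ⟨(E.Hₚ n).map (pairHom ρ d.deform_one), ?_, ?_⟩
  · refine ((E.Hₚ n).map_comp _ _).symm.trans (Eq.trans ?_ ((E.Hₚ n).map_id _))
    exact (E.map_pairHom_eq_of_homotopy (Set.mapsTo_id A) (d.mapsTo_left 1) F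
      d.mapsTo_left n).symm
  · refine ((E.Hₚ n).map_comp _ _).symm.trans (Eq.trans ?_ ((E.Hₚ n).map_id _))
    exact (E.map_pairHom_eq_of_homotopy (Set.mapsTo_id W) (d.mapsTo_right 1) F
      d.mapsTo_right n).symm

end GeneralizedHomology

/-- A homeomorphism of spaces that identifies `A` with `B` is an isomorphism of pairs. -/
theorem isIso_pairHom_of_homeomorph {X Y : TopCat.{u}} {A : Set X} {B : Set Y} (e : X ≃ₜ Y)
    (h : Set.MapsTo e A B) (h' : Set.MapsTo e.symm B A) :
    IsIso (pairHom (e : C(X, Y)) h) := by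
  refine ⟨pairHom (e.symm : C(Y, X)) h', ?_, ?_⟩
  · refine MorphismProperty.Arrow.Hom.ext ?_ ?_ <;> ext x
    · exact Subtype.ext (e.symm_apply_apply _)
    · exact e.symm_apply_apply _
  · refine MorphismProperty.Arrow.Hom.ext ?_ ?_ <;> ext x
    · exact Subtype.ext (e.apply_symm_apply _)
    · exact e.apply_symm_apply _

/-- The projection `X → X/C` restricts to a homeomorphism outside any closed set `A ⊇ C`. -/
def Collapse.homeomorphCompl {X : Type u} [TopologicalSpace X] {A C : Set X} (hC : C ⊆ A)
    (hA : IsClosed A) : ↥(Aᶜ) ≃ₜ ↥((Collapse.image C A)ᶜ) :=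
  Equiv.toHomeomorphOfContinuousOpen
    (Equiv.ofBijective (fun x => ⟨Collapse.mk C x.1, fun h => x.2 ((mk_mem_image hC).1 h)⟩) (by
      constructor
      · intro x y h
        rcases mk_eq_iff.1 (congrArg Subtype.val h) with h | ⟨h, -⟩
        exacts [Subtype.ext h, (x.2 (hC h)).elim]
      · rintro ⟨_ | z, hz⟩
        · exact (hz (Or.inl rfl)).elim
        · have e : mk C z.1 = (some z : Option ↥(Cᶜ)) := mk_of_notMem z.2
          exact ⟨⟨z.1, fun h => hz (Or.inr ⟨_, h, e⟩)⟩, Subtype.ext e⟩))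
    (((continuous_mk C).comp continuous_subtype_val).subtype_mk _)
    (by
      intro U hU
      have hU' : IsOpen (Subtype.val '' U) := hA.isOpen_compl.isOpenMap_subtype_val U hU
      refine isOpen_induced_iff.2 ⟨mk C '' (Subtype.val '' U), isOpen_coinduced.2 ?_, ?_⟩
      · convert hU' using 1
        refine Set.ext fun x => ⟨?_, fun hx => ⟨x, hx, rfl⟩⟩
        rintro ⟨_, ⟨y, hy, rfl⟩, h⟩
        rcases mk_eq_iff.1 h with rfl | ⟨h, -⟩
        exacts [⟨y, hy, rfl⟩, (y.2 (hC h)).elim]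
      · refine Set.ext fun z => ⟨?_, ?_⟩
        · rintro ⟨_, ⟨y, hy, rfl⟩, h⟩
          exact ⟨y, hy, Subtype.ext h⟩
        · rintro ⟨y, hy, rfl⟩
          exact ⟨_, ⟨y, hy, rfl⟩, rfl⟩)

/-- The projection of pairs `(X, A) ⟶ (X/C, A/C)`. -/
def collapseHom {X : TopCat.{u}} (C A : Set X) :
    TopPair.ofSubset A ⟶ TopPair.ofSubset (X := TopCat.of (Collapse C)) (Collapse.image C A) :=
  pairHom (Y := TopCat.of (Collapse C)) ⟨Collapse.mk C, Collapse.continuous_mk C⟩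
    fun x hx => Or.inr ⟨x, hx, rfl⟩

namespace GeneralizedHomology

variable (E : GeneralizedHomology.{u, v})

/-- If `A` deforms within a neighbourhood `W`, then `Eₙ(X, A) ≅ Eₙ(X/C, A/C)` for `C ⊆ A`: one may
enlarge `A` to `W`, and excise `A`, on whose complement the projection is a homeomorphism. -/
theorem isIso_map_collapseHom {X : TopCat.{u}} {A W C : Set X} (d : NhdDeformation A W)
    (hC : C ⊆ A) (hd : ∀ t, Set.MapsTo (fun x => d.deform (t, x)) C C) (n : ℤ) :
    IsIso ((E.Hₚ n).map (collapseHom C A)) := by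
  let d' := d.collapse hC hd
  have h₁ := E.isIso_map_nhd d n
  have h₂ := E.isIso_map_nhd (X := TopCat.of (Collapse C)) d' n
  have h₃ := E.excision X W A
    (by rw [d.isClosed.closure_eq, d.isOpen.interior_eq]; exact d.subset) n
  have h₄ := E.excision (TopCat.of (Collapse C)) (Collapse.image C W) (Collapse.image C A)
    (by rw [d'.isClosed.closure_eq, d'.isOpen.interior_eq]; exact d'.subset) n
  let e := Collapse.homeomorphCompl hC d.isClosed
  let c : TopPair.ofSubset (X := TopCat.of ↥(Aᶜ)) {x | (x : X) ∈ W} ⟶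
      TopPair.ofSubset (X := TopCat.of ↥((Collapse.image C A)ᶜ))
        {z | (z : Collapse C) ∈ Collapse.image C W} :=
    pairHom (X := TopCat.of ↥(Aᶜ)) (Y := TopCat.of ↥((Collapse.image C A)ᶜ))
      (e : C(↥(Aᶜ), ↥((Collapse.image C A)ᶜ)))
      fun x hx => (Collapse.mk_mem_image (hC.trans d.subset)).2 hx
  have h₅ : IsIso c := by
    refine isIso_pairHom_of_homeomorph (X := TopCat.of ↥(Aᶜ))
      (Y := TopCat.of ↥((Collapse.image C A)ᶜ)) e _ ?_
    intro z hz
    obtain ⟨x, rfl⟩ := e.surjective z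
    rw [Homeomorph.symm_apply_apply]
    exact (Collapse.mk_mem_image (hC.trans d.subset)).1 hz
  have hW : IsIso ((E.Hₚ n).map (collapseHom C W)) := by
    have h : CommSq (excisionMap X W A) c (collapseHom C W) (excisionMap (TopCat.of (Collapse C))
        (Collapse.image C W) (Collapse.image C A)) := ⟨rfl⟩
    exact IsIso.of_isIso_fac_left (h.map (E.Hₚ n)).w
  have h : CommSq (collapseHom C A) (inclHom d.subset)
    (inclHom (X := TopCat.of (Collapse C)) d'.subset) (collapseHom C W) := ⟨rfl⟩
  exact IsIso.of_isIso_fac_right (h.map (E.Hₚ n)).w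

end GeneralizedHomology

/-- The identification of a pair given by an embedding `i : A → X` with the pair `(X, i(A))`. -/
def rangeHom {A X : TopCat.{u}} (i : A ⟶ X) (hi : IsEmbedding i) :
    TopPair.of i hi ⟶ TopPair.ofSubset (Set.range i) :=
  TopPair.ofHom (X := TopPair.of i hi) (Y := TopPair.ofSubset (Set.range i)) (𝟙 X)
    (TopCat.ofHom ⟨fun a => ⟨i a, a, rfl⟩, i.hom.continuous.subtype_mk _⟩) (by ext x; rfl)

theorem isIso_rangeHom {A X : TopCat.{u}} (i : A ⟶ X) (hi : IsEmbedding i) :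
    IsIso (rangeHom i hi) := by
  let e := hi.toHomeomorph
  refine ⟨TopPair.ofHom (X := TopPair.ofSubset (Set.range i)) (Y := TopPair.of i hi) (𝟙 X)
    (TopCat.ofHom (e.symm : C(Set.range i, A))) ?_, ?_, ?_⟩
  · ext x
    exact congrArg Subtype.val (e.apply_symm_apply x)
  · refine MorphismProperty.Arrow.Hom.ext ?_ ?_ <;> ext x
    · exact e.symm_apply_apply x
    · rfl
  · refine MorphismProperty.Arrow.Hom.ext ?_ ?_ <;> ext x
    · exact e.apply_symm_apply x
    · rfl

namespace GeneralizedHomology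

variable (E : GeneralizedHomology.{u, v})

theorem isIso_map_rangeHom_comp {A X : TopCat.{u}} {i : A ⟶ X} (hi : IsEmbedding i)
    {P : TopPair.{u}} {q : TopPair.ofSubset (Set.range i) ⟶ P} {n : ℤ}
    (hq : IsIso ((E.Hₚ n).map q)) : IsIso ((E.Hₚ n).map (rangeHom i hi ≫ q)) := by
  have := isIso_rangeHom i hi
  rw [Functor.map_comp]
  infer_instance

/-- The statement of `isIso_map_collapseHom` for any description `B` of the image of `A` in `X/C`. -/
theorem isIso_map_collapseMk {X : TopCat.{u}} {A W C : Set X} {B : Set (Collapse C)}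
    (d : NhdDeformation A W) (hC : C ⊆ A) (hd : ∀ t, Set.MapsTo (fun x => d.deform (t, x)) C C)
    (hB : Collapse.image C A = B) (h : Set.MapsTo (Collapse.mk C) A B) (n : ℤ) :
    IsIso ((E.Hₚ n).map (pairHom (Y := TopCat.of (Collapse C))
      ⟨Collapse.mk C, Collapse.continuous_mk C⟩ h)) := by
  subst hB
  exact E.isIso_map_collapseHom d hC hd n

end GeneralizedHomology

/-! ### The suspension isomorphism -/

/-- A pointed space is well-pointed if its base point is closed and has a neighbourhood that is
deformed into it by a pointed deformation of the whole space. -/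
def PtdSpace.WellPointed (Y : PtdSpace.{u}) : Prop :=
  ∃ W, Nonempty (NhdDeformation {Y.pt} W)

/-- The product of the deformation of `Y` with that of `([0,1], {0, 1})`. It preserves the subspace
collapsed in the cone, so that it descends to the cone as well as to the suspension. -/
theorem PtdSpace.WellPointed.exists_suspSet {Y : PtdSpace.{u}} (h : Y.WellPointed) :
    ∃ W, ∃ d : NhdDeformation (suspSet Y) W,
      ∀ t, Set.MapsTo (fun x => d.deform (t, x)) (coneSet Y) (coneSet Y) := by
  obtain ⟨W, ⟨d⟩⟩ := h
  have hs : suspSet Y = {p : Y.carrier × unitInterval |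
      p.1 ∈ ({Y.pt} : Set Y.carrier) ∨ p.2 ∈ {s : unitInterval | s = 0 ∨ s = 1}} := by
    ext p
    simp only [suspSet, Set.mem_ofPred_eq, Set.mem_singleton_iff]
    tauto
  rw [hs]
  refine ⟨_, d.prod unitIntervalEnds, fun t p hp => ?_⟩
  rcases hp with hp | hp
  · refine Or.inl (Set.projIcc_of_le_left zero_le_one ?_)
    have := t.2.1
    simp [hp]
    linarith
  · exact Or.inr (d.mapsTo_left t hp)

theorem coneSet_subset_suspSet (Y : PtdSpace.{u}) : coneSet Y ⊆ suspSet Y := by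
  rintro p (h | h)
  exacts [Or.inl h, Or.inr (Or.inr h)]

theorem PtdSpace.WellPointed.susp {Y : PtdSpace.{u}} (h : Y.WellPointed) :
    (susp Y).WellPointed := by
  obtain ⟨W, d, -⟩ := h.exists_suspSet
  have d' := d.collapse subset_rfl d.mapsTo_left
  rw [Collapse.image_self] at d'
  exact ⟨_, ⟨d'⟩⟩

/-- Collapsing to the cone, the set `Y × {0, 1} ∪ {pt} × [0,1]` becomes the base of the
cone, whose base point `[pt, 1]` is also the tip `[y, 0]`. -/
theorem image_suspSet (Y : PtdSpace.{u}) :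
    Collapse.image (coneSet Y) (suspSet Y) = Set.range (coneBase Y) := by
  refine Set.ext fun z => ⟨?_, ?_⟩
  · have h₀ : (none : Option ↥((coneSet Y)ᶜ)) ∈ Set.range (coneBase Y) :=
      ⟨Y.pt, Collapse.mk_of_mem (A := coneSet Y) (Or.inr rfl)⟩
    rintro (rfl | ⟨⟨y, s⟩, hp | hp | hp, rfl⟩)
    · exact h₀
    · exact (Collapse.mk_of_mem (A := coneSet Y) (x := (y, s)) (Or.inl hp)) ▸ h₀
    · obtain rfl : s = 1 := hp
      exact ⟨y, rfl⟩
    · exact (Collapse.mk_of_mem (A := coneSet Y) (x := (y, s)) (Or.inr hp)) ▸ h₀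
  · rintro ⟨y, rfl⟩
    exact Or.inr ⟨(y, 1), Or.inr (Or.inl rfl), rfl⟩

namespace GeneralizedHomology

variable (E : GeneralizedHomology.{u, v})

/-- Both pairs are compared with `(Y × [0,1], Y × {0, 1} ∪ {pt} × [0,1])`. -/
theorem isIso_map_coneToSusp {Y : PtdSpace.{u}} (hY : Y.WellPointed) (n : ℤ) :
    IsIso ((E.Hₚ n).map (coneToSusp Y)) := by
  obtain ⟨W, d, hd⟩ := hY.exists_suspSet
  let S : TopPair.{u} := TopPair.ofSubset (X := TopCat.of (Y.carrier × unitInterval)) (suspSet Y)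
  let q₁ : S ⟶ TopPair.ofSubset (Set.range (coneBase Y)) :=
    pairHom (X := TopCat.of (Y.carrier × unitInterval)) (Y := (cone Y).carrier)
      ⟨Collapse.mk (coneSet Y), Collapse.continuous_mk _⟩
      fun p hp => image_suspSet Y ▸ Or.inr ⟨p, hp, rfl⟩
  let q₃ : S ⟶ ptdPair (susp Y) :=
    pairHom (X := TopCat.of (Y.carrier × unitInterval)) (Y := (susp Y).carrier)
      ⟨Collapse.mk (suspSet Y), Collapse.continuous_mk _⟩ fun p hp => Collapse.mk_of_mem hp
  have hmk : ∀ p, (quotMap (coneSet_subset_suspSet Y)).map (Collapse.mk (coneSet Y) p) =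
      Collapse.mk (suspSet Y) p :=
    Collapse.lift_mk fun _ hx => Collapse.mk_of_mem (coneSet_subset_suspSet Y hx)
  have hbase : ∀ y, (quotMap (coneSet_subset_suspSet Y)).map (coneBase Y y) = (susp Y).pt :=
    fun y => (hmk (y, 1)).trans (Collapse.mk_of_mem (Or.inr (Or.inl rfl)))
  let q₂ : TopPair.ofSubset (Set.range (coneBase Y)) ⟶ ptdPair (susp Y) :=
    pairHom (quotMap (coneSet_subset_suspSet Y)).map (by rintro _ ⟨y, rfl⟩; exact hbase y)
  have h₁ : IsIso ((E.Hₚ n).map q₁) :=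
    E.isIso_map_collapseMk (X := TopCat.of (Y.carrier × unitInterval)) d
      (coneSet_subset_suspSet Y) hd (image_suspSet Y) _ n
  have h₃ : IsIso ((E.Hₚ n).map q₃) :=
    E.isIso_map_collapseMk (X := TopCat.of (Y.carrier × unitInterval)) d subset_rfl
      d.mapsTo_left (Collapse.image_self _) _ n
  have h₁₂ : q₁ ≫ q₂ = q₃ := by
    refine MorphismProperty.Arrow.Hom.ext ?_ ?_ <;> ext p
    · exact Subtype.ext (hmk _)
    · exact hmk _
  have h₂ : IsIso ((E.Hₚ n).map q₂) :=
    IsIso.of_isIso_fac_left (((E.Hₚ n).map_comp q₁ q₂).symm.trans (congrArg _ h₁₂))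
  have hc : coneToSusp Y = rangeHom (coneBase Y) (coneBase_isEmbedding Y) ≫ q₂ := by
    refine MorphismProperty.Arrow.Hom.ext ?_ ?_ <;> ext p
    · exact Subtype.ext (hbase p).symm
    · rfl
  rw [hc]
  exact E.isIso_map_rangeHom_comp (coneBase_isEmbedding Y) h₂

theorem isIso_suspHom {Y : PtdSpace.{u}} (hY : Y.WellPointed) (m n : ℤ) (h : m + 1 = n) :
    IsIso (E.suspHom Y m n h) := by
  have := E.isIso_coneBoundary Y m n h
  have := E.isIso_map_coneToSusp hY n
  exact inferInstanceAs (IsIso (inv (E.coneBoundary Y m n) ≫ (E.Hₚ n).map (coneToSusp Y)))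

theorem isIso_reducedMap_id (n : ℤ) (Y : PtdSpace.{u}) :
    IsIso (E.reducedMap n (PtdMap.id Y)) :=
  inferInstanceAs (IsIso ((E.Hₚ n).map (𝟙 (ptdPair Y))))

end GeneralizedHomology

/-! ### Stabilization -/

theorem PtdSpace.WellPointed.iterSusp {Y : PtdSpace.{u}} (h : Y.WellPointed) (j : ℕ) :
    (iterSusp Y j).WellPointed := by
  induction j with
  | zero => exact h
  | succ j ih => exact ih.susp

namespace GeneralizedHomology

variable (E : GeneralizedHomology.{u, v})

/-- For `j ≥ r`, the `j`-th structure map of `Σ⁻ʳ Σ^∞ Y` is an identity map. -/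
theorem isIso_suspHom_bond {Y : PtdSpace.{u}} (hY : Y.WellPointed) (r j : ℕ) (hj : r ≤ j)
    (m n : ℤ) (h : m + 1 = n) :
    IsIso (E.suspHom (((suspSpectrum Y).iterDesusp r).level j) m n h ≫
      E.reducedMap n (((suspSpectrum Y).iterDesusp r).bond j)) := by
  induction r generalizing j with
  | zero =>
    exact IsIso.comp_isIso' (E.isIso_suspHom (hY.iterSusp j) m n h) (E.isIso_reducedMap_id n _)
  | succ r ih =>
    obtain _ | j := j
    · omega
    · exact ih j (by omega)

theorem isEventuallyConstantFrom_spectrumSystem {Y : PtdSpace.{u}} (hY : Y.WellPointed) (r : ℕ)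
    (k : ℤ) : (E.spectrumSystem k ((suspSpectrum Y).iterDesusp r)).IsEventuallyConstantFrom r := by
  intro j φ
  obtain ⟨l, rfl⟩ := Nat.exists_eq_add_of_le (leOfHom φ)
  induction l with
  | zero =>
    obtain rfl : φ = 𝟙 _ := Subsingleton.elim _ _
    infer_instance
  | succ l ih =>
    obtain rfl : φ = homOfLE (Nat.le_add_right r l) ≫ homOfLE (Nat.le_add_right (r + l) 1) :=
      Subsingleton.elim _ _
    have h₁ := ih (homOfLE (Nat.le_add_right r l))
    have h₂ : IsIso ((E.spectrumSystem k ((suspSpectrum Y).iterDesusp r)).map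
        (homOfLE (Nat.le_add_right (r + l) 1))) := by
      rw [spectrumSystem, Functor.ofSequence_map_homOfLE_succ]
      exact E.isIso_suspHom_bond hY r (r + l) (by omega) _ _ _
    rw [Functor.map_comp]
    infer_instance

theorem isIso_reducedMap_bottom (Y : PtdSpace.{u}) (r : ℕ) (n : ℤ) :
    IsIso (E.reducedMap n ((suspSpectrum Y).bottom r)) := by
  induction r with
  | zero =>
    exact E.isIso_reducedMap_id n _
  | succ r ih => exact ih

theorem isIso_stabilize {Y : PtdSpace.{u}} (hY : Y.WellPointed) (r : ℕ) (n : ℤ) :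
    IsIso (E.stabilize Y r n) := by
  have h₂ : IsIso (Limits.colimit.ι (E.spectrumSystem (n - r) ((suspSpectrum Y).iterDesusp r)) r) :=
    (E.isEventuallyConstantFrom_spectrumSystem hY r (n - r)).isIso_ι_of_isColimit
      (Limits.colimit.isColimit _)
  exact IsIso.comp_isIso' (E.isIso_reducedMap_bottom Y r n) (IsIso.comp_isIso' inferInstance h₂)

end GeneralizedHomology

/-! ### Fibrewise scaling in the disc bundle -/

/-- Multiplication of a vector of a bundle by a real number. -/
def scale {X F : Type*} {V : X → Type*} [∀ x, AddCommGroup (V x)] [∀ x, Module ℝ (V x)] (c : ℝ)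
    (p : TotalSpace F V) : TotalSpace F V := ⟨p.proj, c • p.2⟩

theorem scale_scale {X F : Type*} {V : X → Type*} [∀ x, AddCommGroup (V x)]
    [∀ x, Module ℝ (V x)] (a b : ℝ) (p : TotalSpace F V) :
    scale a (scale b p) = scale (a * b) p :=
  congrArg (TotalSpace.mk p.proj) (smul_smul a b p.2)

theorem scale_one {X F : Type*} {V : X → Type*} [∀ x, AddCommGroup (V x)]
    [∀ x, Module ℝ (V x)] (p : TotalSpace F V) : scale 1 p = p :=
  congrArg (TotalSpace.mk p.proj) (one_smul ℝ p.2)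

section Scaling

variable {r : ℕ} {X : Type u} [TopologicalSpace X] {V : X → Type u}
  [TopologicalSpace (TotalSpace (EuclideanSpace ℝ (Fin r)) V)]
  [∀ x, TopologicalSpace (V x)] [∀ x, AddCommGroup (V x)] [∀ x, Module ℝ (V x)]
  [FiberBundle (EuclideanSpace ℝ (Fin r)) V] [VectorBundle ℝ (EuclideanSpace ℝ (Fin r)) V]
  (g : ContinuousRiemannianMetric (EuclideanSpace ℝ (Fin r)) V)

/-- The length of a vector of `V`. -/
def len (p : TotalSpace (EuclideanSpace ℝ (Fin r)) V) : ℝ := √(g.inner p.proj p.2 p.2)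

theorem continuous_len : Continuous (len g) := by
  have h := (g.continuous.comp (FiberBundle.continuous_proj (EuclideanSpace ℝ (Fin r)) V))
  have h' : Continuous fun p : TotalSpace (EuclideanSpace ℝ (Fin r)) V =>
      TotalSpace.mk' ℝ (E := Bundle.Trivial X ℝ) p.proj (g.inner p.proj p.2 p.2) :=
    h.clm_bundle_apply₂ (F₁ := EuclideanSpace ℝ (Fin r)) (F₂ := EuclideanSpace ℝ (Fin r))
      continuous_id continuous_id
  refine Real.continuous_sqrt.comp (continuous_iff_continuousAt.2 fun p => ?_)
  exact ((FiberBundle.continuousAt_totalSpace _ _).1 h'.continuousAt).2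

theorem continuous_scale {T : Type*} [TopologicalSpace T] {c : T → ℝ}
    {p : T → TotalSpace (EuclideanSpace ℝ (Fin r)) V} (hc : Continuous c) (hp : Continuous p) :
    Continuous fun t => scale (c t) (p t) := by
  refine continuous_iff_continuousAt.2 fun t => ?_
  obtain ⟨h₁, h₂⟩ := (FiberBundle.continuousAt_totalSpace _ _).1 (hp.continuousAt (x := t))
  refine (FiberBundle.continuousAt_totalSpace _ _).2 ⟨h₁, ?_⟩
  refine (hc.continuousAt.smul h₂).congr ?_
  have hb := h₁.preimage_mem_nhds ((trivializationAt (EuclideanSpace ℝ (Fin r)) V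
    (p t).proj).open_baseSet.mem_nhds (FiberBundle.mem_baseSet_trivializationAt' _))
  filter_upwards [hb] with s hs
  exact ((Trivialization.linear ℝ (trivializationAt (EuclideanSpace ℝ (Fin r)) V (p t).proj)
    hs).map_smul (c s) (p s).2).symm

theorem len_scale (c : ℝ) (p : TotalSpace (EuclideanSpace ℝ (Fin r)) V) :
    len g (scale c p) = |c| * len g p := by
  have h : g.inner p.proj (c • p.2) (c • p.2) = c ^ 2 * g.inner p.proj p.2 p.2 := by
    simp
    ring
  change √(g.inner p.proj (c • p.2) (c • p.2)) = _
  rw [h, Real.sqrt_mul (sq_nonneg c), Real.sqrt_sq_eq_abs]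
  rfl

theorem len_nonneg (p : TotalSpace (EuclideanSpace ℝ (Fin r)) V) : 0 ≤ len g p :=
  Real.sqrt_nonneg _

theorem len_le_one_iff (p : TotalSpace (EuclideanSpace ℝ (Fin r)) V) :
    len g p ≤ 1 ↔ g.inner p.proj p.2 p.2 ≤ 1 := by
  rw [len, Real.sqrt_le_iff]
  simp

theorem len_eq_one_iff (p : TotalSpace (EuclideanSpace ℝ (Fin r)) V) :
    len g p = 1 ↔ g.inner p.proj p.2 p.2 = 1 := Real.sqrt_eq_one

theorem mem_range_sphereIncl {p : Disc g} : p ∈ Set.range (sphereIncl g) ↔ len g p.1 = 1 := by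
  rw [len_eq_one_iff]
  refine ⟨?_, fun h => ⟨⟨p.1, h⟩, rfl⟩⟩
  rintro ⟨q, rfl⟩
  exact q.2

/-- A scalar multiple, of length at most one, of a vector in the disc bundle. -/
def scaleDisc (c : ℝ) (p : Disc g) (h : |c| * len g p.1 ≤ 1) : Disc g :=
  ⟨scale c p.1, (len_le_one_iff g _).1 ((len_scale g c p.1).trans_le h)⟩

/-- The factor by which vectors of length `l` are scaled in the radial deformation at time `t`:
at time `1` the vectors of length at least `1/2` reach the unit sphere. -/
def radialFactor (t l : ℝ) : ℝ := 1 + t * ((max l (1 / 2))⁻¹ - 1)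

theorem continuous_radialFactor {T : Type*} [TopologicalSpace T] {t l : T → ℝ}
    (ht : Continuous t) (hl : Continuous l) : Continuous fun x => radialFactor (t x) (l x) := by
  refine continuous_const.add (ht.mul (Continuous.sub ?_ continuous_const))
  refine (hl.max continuous_const).inv₀ fun x => ?_
  have := le_max_right (l x) (1 / 2)
  linarith

theorem one_le_radialFactor {t l : ℝ} (ht : 0 ≤ t) (hl : l ≤ 1) : 1 ≤ radialFactor t l := by
  have h : 1 ≤ (max l (1 / 2))⁻¹ :=
    (one_le_inv₀ (lt_max_of_lt_right (by norm_num))).2 (max_le hl (by norm_num))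
  have := mul_nonneg ht (sub_nonneg.2 h)
  unfold radialFactor
  linarith

theorem radialFactor_mul_le {t l : ℝ} (ht : t ≤ 1) (ht' : 0 ≤ t) (hl : l ≤ 1) :
    radialFactor t l * l ≤ 1 := by
  have h : (max l (1 / 2))⁻¹ * l ≤ 1 :=
    inv_mul_le_one_of_le₀ (le_max_left _ _) (le_max_of_le_right (by norm_num))
  calc radialFactor t l * l = (1 - t) * l + t * ((max l (1 / 2))⁻¹ * l) := by
        unfold radialFactor; ring
    _ ≤ (1 - t) * 1 + t * 1 := by gcongr
    _ = 1 := by ring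

theorem radialFactor_one_mul {l : ℝ} (hl : 1 / 2 ≤ l) : radialFactor 1 l * l = 1 := by
  have h0 : l ≠ 0 := by linarith
  rw [radialFactor, max_eq_left hl]
  field_simp
  ring

/-- The sphere bundle in the disc bundle, with the vectors of length greater than `1/2`, which are
pushed radially onto the sphere. -/
def sphereNhd : NhdDeformation (X := Disc g) (Set.range (sphereIncl g))
    {p | 1 / 2 < len g p.1} :=
  have hle : ∀ p : Disc g, len g p.1 ≤ 1 := fun p => (len_le_one_iff g _).2 p.2
  have hr : ∀ (t : unitInterval) (p : Disc g),
      |radialFactor t (len g p.1)| = radialFactor t (len g p.1) := fun t p =>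
    abs_of_nonneg (zero_le_one.trans (one_le_radialFactor t.2.1 (hle p)))
  have hlen : Continuous fun p : Disc g => len g p.1 :=
    (continuous_len g).comp continuous_subtype_val
  have hS : Set.range (sphereIncl g) = {p | len g p.1 = 1} :=
    Set.ext fun p => mem_range_sphereIncl g
  { isClosed := by
      rw [hS]
      exact isClosed_eq hlen continuous_const
    isOpen := isOpen_lt continuous_const hlen
    subset := fun p hp => by
      have := (mem_range_sphereIncl g).1 hp
      change 1 / 2 < len g p.1
      linarith
    deform := ⟨fun p => scaleDisc g (radialFactor p.1 (len g p.2.1)) p.2 (by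
        rw [hr]
        exact radialFactor_mul_le p.1.2.2 p.1.2.1 (hle _)),
      (continuous_scale (continuous_radialFactor (continuous_subtype_val.comp continuous_fst)
        (hlen.comp continuous_snd)) (continuous_subtype_val.comp continuous_snd)).subtype_mk _⟩
    deform_zero := fun p => Subtype.ext (by
      change scale (radialFactor 0 _) p.1 = p.1
      rw [radialFactor, zero_mul, add_zero, scale_one])
    mapsTo_left := fun t p hp => by
      have h := (mem_range_sphereIncl g).1 hp
      refine (mem_range_sphereIncl g).2 ((len_scale g _ _).trans ?_)
      rw [hr, h, radialFactor]
      norm_num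
    mapsTo_right := fun t p hp => by
      refine lt_of_lt_of_eq ?_ (len_scale g _ _).symm
      rw [hr]
      have h : 1 / 2 < len g p.1 := hp
      exact h.trans_le (le_mul_of_one_le_left (len_nonneg g _)
        (one_le_radialFactor t.2.1 (hle p)))
    deform_one := fun p hp => by
      have h : 1 / 2 < len g p.1 := hp
      refine (mem_range_sphereIncl g).2 ((len_scale g _ _).trans ?_)
      rw [hr]
      exact radialFactor_one_mul h.le }

theorem thomSpace_wellPointed : (thomSpace g).WellPointed := by
  have d := (sphereNhd g).collapse subset_rfl (sphereNhd g).mapsTo_left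
  rw [Collapse.image_self] at d
  exact ⟨_, ⟨d⟩⟩

end Scaling

/-! ### Maps out of the mapping cone -/

section Cofibre

variable {A B : Type u} [TopologicalSpace A] [TopologicalSpace B] (f : C(A, B))

/-- The canonical map from `A × [0,1]` to the mapping cone of `f : A → B`. -/
def cylToCofibre : C(A × unitInterval, (cofibre f).carrier) :=
  ⟨fun p => Quot.mk _ (.inr (.inl p)),
    continuous_quot_mk.comp (continuous_inr.comp continuous_inl)⟩

theorem cylToCofibre_zero (a : A) : cylToCofibre f (a, 0) = toCofibre f (f a) :=
  Quot.sound (.zero a)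

theorem cylToCofibre_one (a : A) : cylToCofibre f (a, 1) = (cofibre f).pt :=
  Quot.sound (.one a)

variable {f}

theorem cofibre_induction {P : (cofibre f).carrier → Prop} (hB : ∀ b, P (toCofibre f b))
    (hA : ∀ p, P (cylToCofibre f p)) (h : P (cofibre f).pt) (z : (cofibre f).carrier) : P z := by
  obtain ⟨b | p | ⟨⟩⟩ := z
  exacts [hB b, hA p, h]

/-- The function on the mapping cone given by compatible functions on its three parts. -/
def cofibreLift {Z : Type*} (φ : B → Z) (χ : A × unitInterval → Z) (z : Z)
    (h₀ : ∀ a, χ (a, 0) = φ (f a)) (h₁ : ∀ a, χ (a, 1) = z) : (cofibre f).carrier → Z :=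
  Quot.lift (Sum.elim φ (Sum.elim χ fun _ => z)) (by
    rintro _ _ (a | a)
    exacts [h₀ a, h₁ a])

theorem continuous_of_prod_cofibre {T Z : Type*} [TopologicalSpace T] [LocallyCompactSpace T]
    [TopologicalSpace Z] {F : T × (cofibre f).carrier → Z}
    (hB : Continuous fun p : T × B => F (p.1, toCofibre f p.2))
    (hA : Continuous fun p : T × (A × unitInterval) => F (p.1, cylToCofibre f p.2))
    (h : Continuous fun t : T => F (t, (cofibre f).pt)) : Continuous F :=
  (isQuotientMap_quot_mk (r := CofibreRel f)).continuous_lift_prod_right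
    (continuous_of_prod_sum hB (continuous_of_prod_sum hA (h.comp continuous_fst)))

theorem continuous_cofibreLift {Z : Type*} [TopologicalSpace Z] {φ : B → Z}
    {χ : A × unitInterval → Z} {z : Z} {h₀ : ∀ a, χ (a, 0) = φ (f a)} {h₁ : ∀ a, χ (a, 1) = z}
    (hφ : Continuous φ) (hχ : Continuous χ) : Continuous (cofibreLift φ χ z h₀ h₁) :=
  continuous_quot_lift _ (hφ.sumElim (hχ.sumElim continuous_const))

end Cofibre

/-! ### The Thom space as a mapping cone -/

section Thom

variable {r : ℕ} {X : Type u} [TopologicalSpace X] {V : X → Type u}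
  [TopologicalSpace (TotalSpace (EuclideanSpace ℝ (Fin r)) V)]
  [∀ x, TopologicalSpace (V x)] [∀ x, AddCommGroup (V x)] [∀ x, Module ℝ (V x)]
  [FiberBundle (EuclideanSpace ℝ (Fin r)) V] [VectorBundle ℝ (EuclideanSpace ℝ (Fin r)) V]
  (g : ContinuousRiemannianMetric (EuclideanSpace ℝ (Fin r)) V)

theorem len_sphere (p : Sphere g) : len g p.1 = 1 := (len_eq_one_iff g _).2 p.2

theorem len_disc (p : Disc g) : len g p.1 ≤ 1 := (len_le_one_iff g _).2 p.2

theorem continuous_len_disc : Continuous fun p : Disc g => len g p.1 :=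
  (continuous_len g).comp continuous_subtype_val

/-- The quotient map `D(V) → Th(X, V)`. -/
def thomMk : C(Disc g, (thomSpace g).carrier) := ⟨Collapse.mk _, Collapse.continuous_mk _⟩

/-- Polar coordinates: the map `S(V) × [0,1] → D(V)` sending `(v, s)` to `s v`. -/
def polar : C(Sphere g × unitInterval, Disc g) where
  toFun p := scaleDisc g p.2 ⟨p.1.1, p.1.2.le⟩ (by
    have h : |(p.2 : ℝ)| * len g p.1.1 ≤ 1 := by
      rw [len_sphere, abs_of_nonneg p.2.2.1, mul_one]
      exact p.2.2.2
    exact h)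
  continuous_toFun := (continuous_scale (continuous_subtype_val.comp continuous_snd)
    (continuous_subtype_val.comp continuous_fst)).subtype_mk _

theorem len_polar (p : Sphere g × unitInterval) : len g (polar g p).1 = p.2 := by
  refine (len_scale g _ _).trans ?_
  rw [len_sphere, abs_of_nonneg p.2.2.1, mul_one]

theorem thomMk_of_len_eq_one {p : Disc g} (h : len g p.1 = 1) : thomMk g p = (thomSpace g).pt :=
  Collapse.mk_of_mem ((mem_range_sphereIncl g).2 h)

/-- The comparison map from the mapping cone of `S(V) → X` to the Thom space, by polar
coordinates. -/
def cofibreToThom : PtdMap (cofibre (sphereProj g)) (thomSpace g) where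
  map := ⟨cofibreLift (zeroToThom g) ((thomMk g).comp (polar g)) (thomSpace g).pt
    (fun p => congrArg (thomMk g) (Subtype.ext
      (congrArg (TotalSpace.mk p.1.proj) (zero_smul ℝ p.1.2))))
    (fun p => thomMk_of_len_eq_one g (len_polar g (p, 1))),
    continuous_cofibreLift (map_continuous _) (map_continuous _)⟩
  map_pt := rfl

/-- The direction of a vector of length at least `1/2`. -/
def direction : C({p : Disc g // 1 / 2 ≤ len g p.1}, Sphere g) where
  toFun p := ⟨scale (len g p.1.1)⁻¹ p.1.1, by
    have h : 0 < len g p.1.1 := lt_of_lt_of_le (by norm_num) p.2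
    refine (len_eq_one_iff g _).1 ((len_scale g _ _).trans ?_)
    rw [abs_of_pos (inv_pos.2 h), inv_mul_cancel₀ h.ne']⟩
  continuous_toFun := by
    have hc : Continuous fun p : {p : Disc g // 1 / 2 ≤ len g p.1} => len g p.1.1 :=
      (continuous_len_disc g).comp continuous_subtype_val
    refine (continuous_scale (hc.inv₀ fun p => ?_)
      (continuous_subtype_val.comp continuous_subtype_val)).subtype_mk _
    have := p.2
    linarith

open Classical in
/-- The map from the disc bundle to the mapping cone of `S(V) → X` that projects the vectors of
length at most `1/2` to `X` and stretches the others radially. -/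
def discToCofibreFun (p : Disc g) : (cofibre (sphereProj g)).carrier :=
  if h : 1 / 2 ≤ len g p.1 then
    cylToCofibre (sphereProj g)
      (direction g ⟨p, h⟩, Set.projIcc (0 : ℝ) 1 zero_le_one (2 * len g p.1 - 1))
  else toCofibre (sphereProj g) p.1.proj

theorem discToCofibreFun_of_le {p : Disc g} (h : 1 / 2 ≤ len g p.1) :
    discToCofibreFun g p = cylToCofibre (sphereProj g)
      (direction g ⟨p, h⟩, Set.projIcc (0 : ℝ) 1 zero_le_one (2 * len g p.1 - 1)) := dif_pos h

theorem discToCofibreFun_of_ge {p : Disc g} (h : len g p.1 ≤ 1 / 2) :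
    discToCofibreFun g p = toCofibre (sphereProj g) p.1.proj := by
  by_cases h' : 1 / 2 ≤ len g p.1
  · rw [discToCofibreFun_of_le g h', Set.projIcc_of_le_left zero_le_one (by linarith)]
    exact cylToCofibre_zero (sphereProj g) _
  · exact dif_neg h'

theorem continuous_discToCofibreFun : Continuous (discToCofibreFun g) := by
  have h₁ : ContinuousOn (discToCofibreFun g) {p | 1 / 2 ≤ len g p.1} := by
    rw [continuousOn_iff_continuous_domRestrict]
    have hc : Continuous fun p : {p : Disc g // 1 / 2 ≤ len g p.1} =>
        Set.projIcc (0 : ℝ) 1 zero_le_one (2 * len g p.1.1 - 1) :=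
      continuous_projIcc.comp ((continuous_const.mul
        ((continuous_len_disc g).comp continuous_subtype_val)).sub continuous_const)
    exact ((cylToCofibre (sphereProj g)).continuous.comp
      ((direction g).continuous.prodMk hc)).congr fun p => (discToCofibreFun_of_le g p.2).symm
  have h₂ : ContinuousOn (discToCofibreFun g) {p | len g p.1 ≤ 1 / 2} := by
    have hc : Continuous fun p : Disc g => toCofibre (sphereProj g) p.1.proj :=
      (toCofibre (sphereProj g)).continuous.comp
        ((FiberBundle.continuous_proj _ _).comp continuous_subtype_val)
    exact hc.continuousOn.congr fun p hp => discToCofibreFun_of_ge g hp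
  have h := h₁.union_of_isClosed h₂ (isClosed_le continuous_const (continuous_len_disc g))
    (isClosed_le (continuous_len_disc g) continuous_const)
  rw [← continuousOn_univ]
  exact h.mono fun p _ => le_total (1 / 2) (len g p.1)

theorem discToCofibreFun_of_mem {p : Disc g} (hp : p ∈ Set.range (sphereIncl g)) :
    discToCofibreFun g p = (cofibre (sphereProj g)).pt := by
  have h := (mem_range_sphereIncl g).1 hp
  rw [discToCofibreFun_of_le g (by rw [h]; norm_num),
    Set.projIcc_of_right_le zero_le_one (by rw [h]; norm_num)]
  exact cylToCofibre_one (sphereProj g) _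

/-- A homotopy inverse of the comparison map. -/
def thomToCofibre : PtdMap (thomSpace g) (cofibre (sphereProj g)) where
  map := ⟨Collapse.lift (discToCofibreFun g) (cofibre (sphereProj g)).pt,
    Collapse.continuous_lift (continuous_discToCofibreFun g)
      fun _ => discToCofibreFun_of_mem g⟩
  map_pt := rfl

theorem thomToCofibre_mk (p : Disc g) :
    (thomToCofibre g).map (thomMk g p) = discToCofibreFun g p :=
  Collapse.lift_mk (fun _ => discToCofibreFun_of_mem g) p

theorem len_zeroToDisc (x : X) : len g (zeroToDisc g x).1 = 0 := by
  change √(g.inner x 0 0) = 0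
  simp

theorem thomToCofibre_comp_homotopic :
    ((thomToCofibre g).map.comp (cofibreToThom g).map).HomotopicRel (ContinuousMap.id _)
      {(cofibre (sphereProj g)).pt} := by
  -- The cone coordinate `s` moves linearly from `2 s - 1`, clamped to `[0,1]`, to `s`.
  let c : unitInterval × unitInterval → unitInterval := fun q =>
    Set.projIcc (0 : ℝ) 1 zero_le_one (q.2 + (1 - q.1) * (q.2 - 1))
  have hc : Continuous c := continuous_projIcc.comp (by fun_prop)
  have hc0 : ∀ t, c (t, 0) = 0 := fun t => Set.projIcc_of_le_left zero_le_one (by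
    have := t.2.2
    simpa using this)
  have hc1 : ∀ t, c (t, 1) = 1 := fun t => Set.projIcc_of_right_le zero_le_one (by simp)
  let F : unitInterval × (cofibre (sphereProj g)).carrier → (cofibre (sphereProj g)).carrier :=
    fun q => cofibreLift (toCofibre (sphereProj g))
      (fun p => cylToCofibre (sphereProj g) (p.1, c (q.1, p.2))) (cofibre (sphereProj g)).pt
      (fun a => by rw [hc0]; exact cylToCofibre_zero _ a)
      (fun a => by rw [hc1]; exact cylToCofibre_one _ a) q.2
  have hF : Continuous F := by
    refine continuous_of_prod_cofibre ?_ ?_ continuous_const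
    · exact (toCofibre (sphereProj g)).continuous.comp continuous_snd
    · exact (cylToCofibre (sphereProj g)).continuous.comp
        (by fun_prop : Continuous fun p : unitInterval × (Sphere g × unitInterval) =>
          (p.2.1, c (p.1, p.2.2)))
  refine ⟨⟨⟨⟨F, hF⟩, ?_, ?_⟩, ?_⟩⟩
  · refine cofibre_induction (fun x => ?_) (fun p => ?_) rfl
    · refine Eq.symm ((thomToCofibre_mk g (zeroToDisc g x)).trans ?_)
      exact discToCofibreFun_of_ge g ((len_zeroToDisc g x).trans_le (by norm_num))
    · refine Eq.symm ((thomToCofibre_mk g (polar g p)).trans ?_)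
      have hs : ((p.2 : ℝ) + (1 - (0 : unitInterval)) * (p.2 - 1)) = 2 * p.2 - 1 := by
        simp; ring
      change _ = cylToCofibre (sphereProj g) (p.1, Set.projIcc (0 : ℝ) 1 zero_le_one _)
      rw [hs]
      rcases le_total (1 / 2) (p.2 : ℝ) with h | h
      · refine (discToCofibreFun_of_le g (by rw [len_polar]; exact h)).trans
          (congrArg (cylToCofibre (sphereProj g)) (Prod.ext ?_ (by dsimp only; rw [len_polar])))
        refine Subtype.ext ((scale_scale _ _ _).trans ?_)
        change scale ((len g (polar g p).1)⁻¹ * (p.2 : ℝ)) p.1.1 = p.1.1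
        rw [len_polar, inv_mul_cancel₀ (by linarith), scale_one]
      · rw [discToCofibreFun_of_ge g (by rw [len_polar]; exact h),
          Set.projIcc_of_le_left zero_le_one (by linarith)]
        exact (cylToCofibre_zero (sphereProj g) p.1).symm
  · refine cofibre_induction (fun x => rfl) (fun p => ?_) rfl
    have hs : ((p.2 : ℝ) + (1 - (1 : unitInterval)) * (p.2 - 1)) = p.2 := by simp
    change cylToCofibre (sphereProj g) (p.1, Set.projIcc (0 : ℝ) 1 zero_le_one _) = _
    rw [hs, Set.projIcc_val]
    rfl
  · rintro t _ rfl
    rfl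

/-- The factor by which the composite `Th(X, V) → C(π) → Th(X, V)` scales vectors of length `l`. -/
def stretchFactor (l : ℝ) : ℝ := max 0 (2 - (max l (1 / 2))⁻¹)

theorem continuous_stretchFactor : Continuous stretchFactor := by
  refine continuous_const.max (continuous_const.sub ?_)
  refine (continuous_id.max continuous_const).inv₀ fun l => ?_
  have := le_max_right l (1 / 2)
  exact (lt_of_lt_of_le (by norm_num) this).ne'

theorem stretchFactor_nonneg (l : ℝ) : 0 ≤ stretchFactor l := le_max_left _ _

theorem stretchFactor_le_one {l : ℝ} (hl : l ≤ 1) : stretchFactor l ≤ 1 := by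
  have h : 1 ≤ (max l (1 / 2))⁻¹ :=
    (one_le_inv₀ (lt_max_of_lt_right (by norm_num))).2 (max_le hl (by norm_num))
  exact max_le zero_le_one (by linarith)

theorem stretchFactor_of_le {l : ℝ} (hl : l ≤ 1 / 2) : stretchFactor l = 0 := by
  rw [stretchFactor, max_eq_right hl]
  norm_num

theorem stretchFactor_of_ge {l : ℝ} (hl : 1 / 2 ≤ l) : stretchFactor l = 2 - l⁻¹ := by
  rw [stretchFactor, max_eq_left hl, max_eq_right]
  have : l⁻¹ ≤ (1 / 2)⁻¹ := inv_anti₀ (by norm_num) hl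
  norm_num at this
  linarith

theorem cofibreToThom_comp_homotopic :
    ((cofibreToThom g).map.comp (thomToCofibre g).map).HomotopicRel (ContinuousMap.id _)
      {(thomSpace g).pt} := by
  let c : unitInterval × ℝ → ℝ := fun q => (1 - q.1) * stretchFactor q.2 + q.1
  have hc : Continuous c := by
    have := continuous_stretchFactor
    fun_prop
  have hc0 : ∀ q, 0 ≤ c q := fun q =>
    add_nonneg (mul_nonneg (sub_nonneg.2 q.1.2.2) (stretchFactor_nonneg _)) q.1.2.1
  have hc1 : ∀ t l, l ≤ 1 → c (t, l) ≤ 1 := fun t l hl => by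
    have h₁ := mul_le_mul_of_nonneg_left (stretchFactor_le_one hl) (sub_nonneg.2 t.2.2)
    change (1 - (t : ℝ)) * stretchFactor l + t ≤ 1
    linarith
  let G : unitInterval × Disc g → Disc g := fun q => scaleDisc g (c (q.1, len g q.2.1)) q.2 (by
    rw [abs_of_nonneg (hc0 _)]
    exact mul_le_one₀ (hc1 _ _ (len_disc g _)) (len_nonneg g _) (len_disc g _))
  have hG : Continuous G := (continuous_scale
    (hc.comp (continuous_fst.prodMk ((continuous_len_disc g).comp continuous_snd)))
    (continuous_subtype_val.comp continuous_snd)).subtype_mk _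
  have hGS : ∀ t, ∀ p ∈ Set.range (sphereIncl g), thomMk g (G (t, p)) = (thomSpace g).pt := by
    intro t p hp
    have h := (mem_range_sphereIncl g).1 hp
    refine thomMk_of_len_eq_one g ((len_scale g _ _).trans ?_)
    rw [abs_of_nonneg (hc0 _), h, mul_one]
    change (1 - (t : ℝ)) * stretchFactor 1 + t = 1
    rw [stretchFactor_of_ge (by norm_num)]
    norm_num
  let F : unitInterval × (thomSpace g).carrier → (thomSpace g).carrier := fun q =>
    Collapse.lift (fun p => thomMk g (G (q.1, p))) (thomSpace g).pt q.2
  have hFmk : ∀ t p, F (t, thomMk g p) = thomMk g (G (t, p)) := fun t =>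
    Collapse.lift_mk (hGS t)
  have hF : Continuous F := Collapse.continuous_of_prod
    (((thomMk g).continuous.comp hG).congr fun q => (hFmk q.1 q.2).symm) continuous_const
  have hind : ∀ {P : (thomSpace g).carrier → Prop}, (∀ p, P (thomMk g p)) →
      P (thomSpace g).pt → ∀ z, P z := by
    rintro P h h₀ (_ | p)
    · exact h₀
    · have e : thomMk g p.1 = (some p : Option _) := Collapse.mk_of_notMem p.2
      exact e ▸ h p.1
  refine ⟨⟨⟨⟨F, hF⟩, ?_, ?_⟩, ?_⟩⟩
  · refine hind (fun p => (hFmk 0 p).trans ?_) rfl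
    change _ = (cofibreToThom g).map ((thomToCofibre g).map (thomMk g p))
    rw [thomToCofibre_mk]
    have hl : c (0, len g p.1) = stretchFactor (len g p.1) := by simp [c]
    rcases le_total (1 / 2) (len g p.1) with h | h
    · rw [discToCofibreFun_of_le g h]
      refine congrArg (thomMk g) (Subtype.ext ?_)
      have hm : 2 * len g p.1 - 1 ∈ Set.Icc (0 : ℝ) 1 := by
        have := len_disc g p
        constructor <;> linarith
      rw [Set.projIcc_of_mem zero_le_one hm]
      refine Eq.trans ?_ (scale_scale _ _ p.1).symm
      change scale (c (0, len g p.1)) p.1 = scale ((2 * len g p.1 - 1) * (len g p.1)⁻¹) p.1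
      rw [hl, stretchFactor_of_ge h]
      congr 1
      have : len g p.1 ≠ 0 := by linarith
      field_simp
    · rw [discToCofibreFun_of_ge g h]
      refine congrArg (thomMk g) (Subtype.ext ?_)
      change scale (c (0, len g p.1)) p.1 = _
      rw [hl, stretchFactor_of_le h]
      exact congrArg (TotalSpace.mk p.1.proj) (zero_smul ℝ p.1.2)
  · refine hind (fun p => (hFmk 1 p).trans ?_) rfl
    refine congrArg (thomMk g) (Subtype.ext ?_)
    change scale (c (1, len g p.1)) p.1 = p.1
    have hl : c (1, len g p.1) = 1 := by simp [c]
    rw [hl, scale_one]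
  · rintro t _ rfl
    rfl

theorem isHomotopyEquiv_cofibreToThom : (cofibreToThom g).IsHomotopyEquiv :=
  ⟨thomToCofibre g, thomToCofibre_comp_homotopic g, cofibreToThom_comp_homotopic g⟩

end Thom

/-! ### The long exact sequence -/

theorem exact_of_iso {A B C A' B' C' : AddCommGrpCat.{v}} {f : A ⟶ B} {g : B ⟶ C} {f' : A' ⟶ B'}
    {g' : B' ⟶ C'} (α : A ≅ A') (β : B ≅ B') (γ : C ≅ C') (hf : f ≫ β.hom = α.hom ≫ f')
    (hg : g ≫ γ.hom = β.hom ≫ g') (h : Function.Exact f g) : Function.Exact f' g' :=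
  Function.Exact.of_ladder_addEquiv_of_exact (f₁₂ := f.hom) (f₂₃ := g.hom) (g₁₂ := f'.hom)
    (g₂₃ := g'.hom) (e₁ := α.addCommGroupIsoToAddEquiv) (e₂ := β.addCommGroupIsoToAddEquiv)
    (e₃ := γ.addCommGroupIsoToAddEquiv) (congrArg AddCommGrpCat.Hom.hom hf.symm)
    (congrArg AddCommGrpCat.Hom.hom hg.symm) h

theorem toRel_naturality (H : TopPair.HomologyPretheory.{u} AddCommGrpCat.{v} (ComplexShape.down ℤ))
    {P Q : TopPair.{u}} (f : P ⟶ Q) (n : ℤ) :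
    (H.H n).map (TopPair.Hom.fst f) ≫ toRel H Q n = toRel H P n ≫ (H.Hₚ n).map f := by
  have h : TopPair.incl.map (TopPair.Hom.fst f) ≫ TopPair.j Q = TopPair.j P ≫ f := by
    refine MorphismProperty.Arrow.Hom.ext ?_ ?_
    · ext x
      exact x.elim
    · rfl
  have h₁ := (H.iso n).hom.naturality (TopPair.Hom.fst f)
  have h₂ : (H.Hₚ n).map (TopPair.incl.map (TopPair.Hom.fst f)) ≫ (H.Hₚ n).map (TopPair.j Q) =
      (H.Hₚ n).map (TopPair.j P) ≫ (H.Hₚ n).map f := by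
    rw [← Functor.map_comp, h, Functor.map_comp]
  unfold toRel
  rw [Category.assoc, ← h₂, ← Category.assoc, h₁, Category.assoc]
  rfl

theorem comp_comp_eq_of_inv_comp {𝒞 : Type*} [Category* 𝒞] {A B C D D' F : 𝒞} (d : A ≅ B)
    {z : B ⟶ C} {q : A ⟶ C} (hz : z = d.inv ≫ q) {t : C ⟶ D} {t' : A ⟶ D'} {m : D' ⟶ D}
    (h : q ≫ t = t' ≫ m) (s : D ⟶ F) : t' ≫ m ≫ s = d.hom ≫ z ≫ t ≫ s := by
  rw [hz, Category.assoc, Iso.hom_inv_id_assoc, reassoc_of% h]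

section Thom

variable {r : ℕ} {X : Type u} [TopologicalSpace X] {V : X → Type u}
  [TopologicalSpace (TotalSpace (EuclideanSpace ℝ (Fin r)) V)]
  [∀ x, TopologicalSpace (V x)] [∀ x, AddCommGroup (V x)] [∀ x, Module ℝ (V x)]
  [FiberBundle (EuclideanSpace ℝ (Fin r)) V] [VectorBundle ℝ (EuclideanSpace ℝ (Fin r)) V]
  (g : ContinuousRiemannianMetric (EuclideanSpace ℝ (Fin r)) V)

/-- The projection `D(V) → X`. -/
def discProj : C(Disc g, X) :=
  ⟨fun p => p.1.proj, (FiberBundle.continuous_proj _ _).comp continuous_subtype_val⟩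

/-- The linear contraction of the disc bundle onto the zero section. -/
def discContraction :
    ((zeroToDisc g).comp (discProj g)).Homotopy (ContinuousMap.id (Disc g)) where
  toFun q := scaleDisc g q.1 q.2 (by
    rw [abs_of_nonneg q.1.2.1]
    exact mul_le_one₀ q.1.2.2 (len_nonneg g _) (len_disc g _))
  continuous_toFun := (continuous_scale (continuous_subtype_val.comp continuous_fst)
    (continuous_subtype_val.comp continuous_snd)).subtype_mk _
  map_zero_left p := Subtype.ext (congrArg (TotalSpace.mk p.1.proj) (zero_smul ℝ p.1.2))
  map_one_left p := Subtype.ext (scale_one p.1)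

namespace GeneralizedHomology

variable (E : GeneralizedHomology.{u, v})

/-- The isomorphism `Eₙ(D(V)) ≅ Eₙ(X)` induced by the projection, inverse to the zero section. -/
def discIso (n : ℤ) : E.space n (TopCat.of (Disc g)) ≅ E.space n (TopCat.of X) where
  hom := (E.H n).map (TopCat.ofHom (discProj g))
  inv := (E.H n).map (TopCat.ofHom (zeroToDisc g))
  hom_inv_id := by
    refine ((E.H n).map_comp _ _).symm.trans (Eq.trans ?_ ((E.H n).map_id _))
    exact E.map_eq_of_homotopy (TopCat.ofHom (discProj g) ≫ TopCat.ofHom (zeroToDisc g)) (𝟙 _)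
      (discContraction g) n
  inv_hom_id := ((E.H n).map_comp _ _).symm.trans ((E.H n).map_id _)

theorem isIso_map_discToThom (n : ℤ) : IsIso ((E.Hₚ n).map (discToThom g)) := by
  let q : TopPair.ofSubset (X := TopCat.of (Disc g)) (Set.range (sphereIncl g)) ⟶
      ptdPair (thomSpace g) :=
    pairHom (X := TopCat.of (Disc g)) (Y := (thomSpace g).carrier) (thomMk g)
      fun p hp => Collapse.mk_of_mem hp
  have hq : IsIso ((E.Hₚ n).map q) :=
    E.isIso_map_collapseMk (X := TopCat.of (Disc g)) (sphereNhd g) subset_rfl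
      (sphereNhd g).mapsTo_left (Collapse.image_self _) _ n
  have h : discToThom g =
      rangeHom (TopCat.ofHom (sphereIncl g)) (sphereIncl_isEmbedding g) ≫ q := by
    refine MorphismProperty.Arrow.Hom.ext ?_ ?_ <;> ext p
    · exact Subtype.ext (Collapse.mk_of_mem (A := Set.range (sphereIncl g)) ⟨p, rfl⟩).symm
    · rfl
  rw [h]
  exact E.isIso_map_rangeHom_comp (sphereIncl_isEmbedding g) hq

/-- The composite isomorphism `Eₙ(D(V), S(V)) ≅ Ẽₙ(Th(X, V)) ≅ Eₙ₋ᵣ(X^{V-r})`. -/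
def thomIso (n : ℤ) :
    (E.Hₚ n).obj (discPair g) ≅ E.spectrum (n - r) (thomSpectrum g) :=
  have := E.isIso_map_discToThom g n
  have h := E.isIso_stabilize (thomSpace_wellPointed g) r n
  asIso ((E.Hₚ n).map (discToThom g)) ≪≫ @asIso _ _ _ _ (E.stabilize (thomSpace g) r n) h

/-- The map `ψ : Eₙ(X) ⟶ Eₙ₋ᵣ(X^{V-r})` induced by the zero section. -/
def thomMap (n : ℤ) : E.space n (TopCat.of X) ⟶ E.spectrum (n - r) (thomSpectrum g) :=
  (E.H n).map (TopCat.ofHom (zeroToThom g)) ≫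
    toRel E.toHomologyPretheory (ptdPair (thomSpace g)) n ≫ E.stabilize (thomSpace g) r n

/-- Under the identifications `Eₙ(D(V)) ≅ Eₙ(X)` and `Eₙ(D(V), S(V)) ≅ Eₙ₋ᵣ(X^{V-r})`, the map
`ψ` is the map `Eₙ(D(V)) ⟶ Eₙ(D(V), S(V))`. -/
theorem toRel_comp_thomIso (n : ℤ) :
    toRel E.toHomologyPretheory (discPair g) n ≫ (E.thomIso g n).hom =
      (E.discIso g n).hom ≫ E.thomMap g n := by
  have hz : (E.H n).map (TopCat.ofHom (zeroToThom g)) =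
      (E.discIso g n).inv ≫ (E.H n).map (TopCat.ofHom (thomMk g)) :=
    (E.H n).map_comp (TopCat.ofHom (zeroToDisc g)) (TopCat.ofHom (thomMk g))
  exact comp_comp_eq_of_inv_comp _ hz
    (toRel_naturality E.toHomologyPretheory (discToThom g) n) (E.stabilize (thomSpace g) r n)

end GeneralizedHomology

end Thom

end SmithLES

end

theorem mainTheorem8 (E : SmithLES.GeneralizedHomology.{u, v}) (r : ℕ)
    (X : Type u) [TopologicalSpace X] [T2Space X] [Topology.CWComplex (Set.univ : Set X)]
    (V : X → Type u)
    [TopologicalSpace (TotalSpace (EuclideanSpace ℝ (Fin r)) V)]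
    [∀ x, TopologicalSpace (V x)] [∀ x, AddCommGroup (V x)] [∀ x, Module ℝ (V x)]
    [FiberBundle (EuclideanSpace ℝ (Fin r)) V] [VectorBundle ℝ (EuclideanSpace ℝ (Fin r)) V]
    (g : ContinuousRiemannianMetric (EuclideanSpace ℝ (Fin r)) V) :
    (∃ h : SmithLES.PtdMap (SmithLES.cofibre (SmithLES.sphereProj g)) (SmithLES.thomSpace g),
      h.IsHomotopyEquiv ∧
      h.map.comp (SmithLES.toCofibre (SmithLES.sphereProj g)) = SmithLES.zeroToThom g) ∧
    ∃ (ψ : ∀ n : ℤ, E.space n (TopCat.of X) ⟶ E.spectrum (n - r) (SmithLES.thomSpectrum g))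
      (bd : ∀ n : ℤ, E.spectrum (n - r) (SmithLES.thomSpectrum g) ⟶
        E.space (n - 1) (TopCat.of (SmithLES.Sphere g))),
      (∀ n : ℤ, ψ n = (E.H n).map (TopCat.ofHom (SmithLES.zeroToThom g)) ≫
        SmithLES.toRel E.toHomologyPretheory (SmithLES.ptdPair (SmithLES.thomSpace g)) n ≫
        E.stabilize (SmithLES.thomSpace g) r n) ∧
      (∀ n : ℤ, (E.Hₚ n).map (SmithLES.discToThom g) ≫
        E.stabilize (SmithLES.thomSpace g) r n ≫ bd n =
          (E.δ n (n - 1)).app (SmithLES.discPair g)) ∧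
      (∀ n : ℤ, Function.Exact
        ((E.H n).map (TopCat.ofHom (SmithLES.sphereProj g))) (ψ n)) ∧
      (∀ n : ℤ, Function.Exact (ψ n) (bd n)) ∧
      (∀ n : ℤ, Function.Exact (bd n)
        ((E.H (n - 1)).map (TopCat.ofHom (SmithLES.sphereProj g)))) := by
  refine ⟨⟨SmithLES.cofibreToThom g, SmithLES.isHomotopyEquiv_cofibreToThom g, rfl⟩, E.thomMap g,
    fun n => (E.thomIso g n).inv ≫ (E.δ n (n - 1)).app (SmithLES.discPair g), fun n => rfl,
    fun n => ?_, fun n => ?_, fun n => ?_, fun n => ?_⟩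
  · refine (Category.assoc _ _ _).symm.trans ?_
    exact (E.thomIso g n).hom_inv_id_assoc ((E.δ n (n - 1)).app (SmithLES.discPair g))
  · exact SmithLES.exact_of_iso (Iso.refl _) (E.discIso g n) (E.thomIso g n)
      (((E.H n).map_comp _ _).symm.trans (Category.id_comp _).symm) (E.toRel_comp_thomIso g n)
      (E.exact_fst (SmithLES.discPair g) n)
  · exact SmithLES.exact_of_iso (E.discIso g n) (E.thomIso g n) (Iso.refl _)
      (E.toRel_comp_thomIso g n)
      ((Category.comp_id _).trans ((E.thomIso g n).hom_inv_id_assoc _).symm)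
      (E.exact_rel (SmithLES.discPair g) n)
  · exact SmithLES.exact_of_iso (E.thomIso g n) (Iso.refl _) (E.discIso g (n - 1))
      ((Category.comp_id _).trans ((E.thomIso g n).hom_inv_id_assoc _).symm)
      (((E.H (n - 1)).map_comp _ _).symm.trans (Category.id_comp _).symm)
      (E.exact_snd (SmithLES.discPair g) n)
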